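/- Let $\mathbb S=\mathbb R/2\pi\mathbb Z$. Let $\Omega\subset\mathbb R^2$ be a bounded strictly convex domain whose boundary is of class $C^2$, and let $\gamma:\mathbb S\to\mathbb R^2$ be an injective, regular ($\gamma'\neq0$), counter-clockwise $C^2$ parametrization of $\partial\Omega$. Assume that $\Omega$ is a Radon domain: it is centrally symmetric, and every point of $\partial\Omega$ is a vertex of an inscribed parallelogram (all four vertices on $\partial\Omega$) whose area is maximal among all inscribed parallelograms. Let the origin $O$ be the center of symmetry of $\Omega$. For $t\in\mathbb S$ let $t^*\ne t$ be the unique parameter with $\gamma'(t^*)$ parallel to $\gamma'(t)$, and let $\hat{\mathcal P}$ be the set of $(t_1,t_2)\in\mathbb S\times\mathbb S$ such that $t_2$ lies strictly between $t_1$ and $t_1^*$ in the positive direction from $t_1$. The symplectic billiard map is $\hat T:\hat{\mathcal P}\to\hat{\mathcal P}$, $\hat T(t_1,t_2)=(t_2,t_3)$, where $\gamma(t_3)\neq\gamma(t_1)$ is the point of $\partial\Omega$ such that $\gamma(t_3)-\gamma(t_1)$ is parallel to $\gamma'(t_2)$. The injective map $\phi(t_1,t_2)=\bigl(t_1,-\det(\gamma'(t_1),\gamma(t_2)-O)\bigr)$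 sends $\hat{\mathcal P}$ onto $$\mathcal P=\{(t,s)\in\mathbb S\times\mathbb R:\ \psi_1(t)<s<\psi_2(t)\},$$ where $\psi_1(t)=-\det(\gamma'(t),\gamma(t^*)-O)$ and $\psi_2(t)=-\det(\gamma'(t),\gamma(t)-O)$. Put $T=\phi\circ\hat T\circ\phi^{-1}:\mathcal P\to\mathcal P$ and, for $\lambda\in(0,1)$, let $T_\lambda=\mathcal H_\lambda\circ T:\mathcal P\to\mathcal P$ with $\mathcal H_\lambda(t,s)=(t,\lambda s)$ be the dissipative symplectic billiard map. The attractor of $T_\lambda$ is $\Lambda_0=\bigcap_{n\ge0}T_\lambda^n(\mathcal P)$. A set $\Lambda\subset\mathbb S\times\mathbb R$ is the Birkhoff attractor of $T_\lambda$ if $\mathcal P\setminus\Lambda_0=U_-\sqcup U_+$ with $U_-,U_+$ disjoint, open and connected, the graph of $\psi_1$ contained in $\partial U_-$, the graph of $\psi_2$ contained in $\partial U_+$, and $\Lambda=\mathrm{cl}(U_-)\cap\mathrm{cl}(U_+)$. Then, for every $\lambda\in(0,1)$, $T_\lambda$ has a Birkhoff attractor, it is unique, and it is exactly the zero section $\Lambda=\mathbb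 S\times\{0\}$. -/

import Mathlib

noncomputable section

namespace SymplecticBilliard

open Set

/-- The plane `ℝ²`. -/
abbrev Plane : Type := EuclideanSpace ℝ (Fin 2)

/-- The circle `𝕊 = ℝ / 2πℤ`. -/
abbrev Circ : Type := AddCircle (2 * Real.pi)

/-- `det(u, v)`, the signed area of the parallelogram spanned by `u` and `v`. -/
def det2 (u v : Plane) : ℝ := u 0 * v 1 - u 1 * v 0

/-! ### Strictly convex domains and parametrizations of their boundary -/

/-- A bounded strictly convex planar domain. For an open set the predicate `StrictConvex` is the
same as convexity, so strict convexity (no segments on the boundary) is asked of the closure. -/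
structure IsStrictlyConvexDomain (Ω : Set Plane) : Prop where
  isOpen : IsOpen Ω
  nonempty : Ω.Nonempty
  isBounded : Bornology.IsBounded Ω
  convex : Convex ℝ Ω
  strictConvex : StrictConvex ℝ (closure Ω)

/-- The derivative `γ'(t)` of a map `γ` defined on the circle. -/
def velocity (γ : Circ → Plane) (t : Circ) : Plane :=
  deriv (fun x : ℝ => γ (t + (x : Circ))) 0

/-- `γ` is a regular parametrization of class `C²`, by the circle, of `∂Ω`, where `∂Ω` has the
counter-clockwise orientation: the domain lies to the left of each oriented tangent line. -/
structure IsBoundaryParametrization (Ω : Set Plane) (γ : Circ → Plane) : Prop where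
  contDiff : ContDiff ℝ 2 (fun x : ℝ => γ (x : Circ))
  regular : ∀ t, velocity γ t ≠ 0
  injective : Function.Injective γ
  range_eq : range γ = frontier Ω
  counterclockwise : ∀ t, ∀ x ∈ Ω, 0 < det2 (velocity γ t) (x - γ t)

/-! ### Radon domains -/

/-- `Ω` is invariant under the point reflection `x ↦ 2 O - x`. -/
def IsCentrallySymmetric (Ω : Set Plane) (O : Plane) : Prop :=
  ∀ x, x ∈ Ω ↔ (2 : ℝ) • O - x ∈ Ω

/-- `p, q, r, s` are the consecutive vertices of a (nondegenerate) parallelogram inscribed in `Ω`: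
the four vertices lie on `∂Ω`. -/
def IsInscribedParallelogram (Ω : Set Plane) (p q r s : Plane) : Prop :=
  p ∈ frontier Ω ∧ q ∈ frontier Ω ∧ r ∈ frontier Ω ∧ s ∈ frontier Ω ∧
    q - p = r - s ∧ det2 (q - p) (s - p) ≠ 0

/-- The area of the parallelogram with consecutive vertices `p, q, p + (q - p) + (s - p), s`. -/
def parallelogramArea (p q s : Plane) : ℝ := |det2 (q - p) (s - p)|

/-- A Radon domain: centrally symmetric, and every boundary point is a vertex of an inscribed
parallelogram of maximal area among all inscribed parallelograms. -/
def IsRadon (Ω : Set Plane) : Prop :=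
  (∃ O, IsCentrallySymmetric Ω O) ∧
    ∀ p ∈ frontier Ω, ∃ q r s, IsInscribedParallelogram Ω p q r s ∧
      ∀ p' q' r' s', IsInscribedParallelogram Ω p' q' r' s' →
        parallelogramArea p' q' s' ≤ parallelogramArea p q s

/-! ### Attractor and Birkhoff attractor of a map of an annulus -/

/-- The open annulus between the graphs of `φm` and `φp`. -/
def annulus (φm φp : Circ → ℝ) : Set (Circ × ℝ) := {p | φm p.1 < p.2 ∧ p.2 < φp p.1}

/-- The graph of a function on the circle. -/
def graph (g : Circ → ℝ) : Set (Circ × ℝ) := {p | p.2 = g p.1}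

/-- The attractor `Λ₀ = ⋂ₙ fⁿ(C)` of a map `f` on `C`. -/
def attractor (f : Circ × ℝ → Circ × ℝ) (C : Set (Circ × ℝ)) : Set (Circ × ℝ) :=
  ⋂ n : ℕ, f^[n] '' C

/-- `Λ` is the Birkhoff attractor of the map `f` of the annulus between the graphs of `φm` and
`φp`: the complement of the attractor in the annulus is the disjoint union of two connected open
sets `Um`, `Up`, whose boundaries contain the lower and the upper boundary curve of the annulus
respectively, and `Λ = cl(Um) ∩ cl(Up)`. -/
def IsBirkhoffAttractor (φm φp : Circ → ℝ) (f : Circ × ℝ → Circ × ℝ) (Λ : Set (Circ × ℝ)) :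
    Prop :=
  ∃ Um Up : Set (Circ × ℝ), IsOpen Um ∧ IsOpen Up ∧ IsConnected Um ∧ IsConnected Up ∧
    Disjoint Um Up ∧ Um ∪ Up = annulus φm φp \ attractor f (annulus φm φp) ∧
    graph φm ⊆ frontier Um ∧ graph φp ⊆ frontier Up ∧
    Λ = closure Um ∩ closure Up

/-! ### Symplectic billiards -/

/-- For a strictly convex domain: `t^*`, the unique point `≠ t` where the tangent line to `∂Ω` is
parallel to the one at `t`. -/
def opposite (γ : Circ → Plane) (t : Circ) : Circ :=
  Classical.epsilon fun u => u ≠ t ∧ det2 (velocity γ t) (velocity γ u) = 0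

/-- `(t₁, t₂)` is positive admissible: going counter-clockwise from `t₁`, one meets `t₂` strictly
before `t₁^*`. Here `x`, `y`, `z` are lifts of `t₁`, `t₁^*`, `t₂`. -/
def PositiveAdmissible (γ : Circ → Plane) (t₁ t₂ : Circ) : Prop :=
  ∃ x y z : ℝ, (x : Circ) = t₁ ∧ (y : Circ) = opposite γ t₁ ∧ (z : Circ) = t₂ ∧
    x < y ∧ y < x + 2 * Real.pi ∧ x < z ∧ z < y

/-- The phase space of the symplectic billiard map, in the coordinates `(t₁, t₂)`. -/
def phaseSpaceHat (γ : Circ → Plane) : Set (Circ × Circ) := {p | PositiveAdmissible γ p.1 p.2}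

/-- The symplectic billiard map `(t₁, t₂) ↦ (t₂, t₃)` (meaningful on `phaseSpaceHat γ`): `γ(t₃)` is
the boundary point other than `γ(t₁)` such that `γ(t₃) - γ(t₁)` is parallel to `γ'(t₂)`. -/
def billiardMapHat (γ : Circ → Plane) (p : Circ × Circ) : Circ × Circ :=
  (p.2, Classical.epsilon fun t₃ => t₃ ≠ p.1 ∧ det2 (velocity γ p.2) (γ t₃ - γ p.1) = 0)

/-- The change of coordinates `(t₁, t₂) ↦ (t₁, s₁)`, `s₁ = -det(γ'(t₁), γ(t₂) - O)`. -/
def coord (γ : Circ → Plane) (O : Plane) (p : Circ × Circ) : Circ × ℝ :=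
  (p.1, -det2 (velocity γ p.1) (γ p.2 - O))

/-- The lower boundary `ψ₁(t) = -det(γ'(t), γ(t^*) - O)` of the phase space. -/
def lowerBoundary (γ : Circ → Plane) (O : Plane) (t : Circ) : ℝ :=
  -det2 (velocity γ t) (γ (opposite γ t) - O)

/-- The upper boundary `ψ₂(t) = -det(γ'(t), γ(t) - O)` of the phase space. -/
def upperBoundary (γ : Circ → Plane) (O : Plane) (t : Circ) : ℝ :=
  -det2 (velocity γ t) (γ t - O)

/-- The symplectic billiard map `T` in the coordinates `(t, s)`, meaningful on the annulus between
`lowerBoundary γ O` and `upperBoundary γ O`, the image of `phaseSpaceHat γ` under `coord γ O`. -/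
def billiardMap (γ : Circ → Plane) (O : Plane) : Circ × ℝ → Circ × ℝ :=
  coord γ O ∘ billiardMapHat γ ∘ Function.invFunOn (coord γ O) (phaseSpaceHat γ)

/-- The contraction `(t, s) ↦ (t, lam * s)` along the fiber. -/
def fiberContraction (lam : ℝ) (p : Circ × ℝ) : Circ × ℝ := (p.1, lam * p.2)

/-- The dissipative symplectic billiard map `T_lam`. -/
def dissipativeBilliardMap (γ : Circ → Plane) (O : Plane) (lam : ℝ) : Circ × ℝ → Circ × ℝ :=
  fiberContraction lam ∘ billiardMap γ O

end SymplecticBilliard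

end

/-!
The curve enters the billiard map only through the tangent vectors: the chord from `γ(t₁)` to
`γ(t₃)` is parallel to `γ'(t₂)`, so that with `height t u = -det(γ'(t), γ(u) - O)` the map is
`(t, height t u) ↦ (u, height u t)` (`billiardMap_coord`). The pairs `(t, u)` of the phase space are
those with `det(γ'(t), γ'(u)) > 0` (`positiveAdmissible_iff`), and central symmetry makes the annulus
symmetric, `|s| < ψ₂(t)`. In the coordinates `(t, u)` both `(t, height t u)` and `(u, height u t)`
have the area density `|det(γ'(t), γ'(u))|`; hence `T` preserves the area
(`volume_image_billiardMap`) and `T_λ` multiplies it by `λ`.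

The zero section consists of the conjugate pairs: `γ(u) - O` is parallel to `γ'(t)`. A maximal
inscribed parallelogram of a Radon domain has its diagonals through the center, since otherwise half
a diagonal, moved to the center, would end inside the domain and could be prolonged. So every
boundary point `γ(t)` has a partner `γ(u)` with `|det(γ(t) - O, γ(u) - O)|` maximal, and vanishing of
both partial derivatives says that conjugacy is a symmetric relation
(`IsRadon.height_eq_zero_symm`). Therefore `T_λ` maps the zero section, and nothing else, onto the
zero section.

These properties suffice (`IsDissipativeEmbedding.isBirkhoffAttractor_iff`). The attractor is
compact, contains the zero section, and has area zero because the areas of the iterated images decay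
like `λⁿ`; so it has empty interior. In either half of the annulus the complement of the attractor is
the union of the iterates of the collar `λ ψ₂ ≤ |s| < ψ₂`, each of which touches the next, because
`T` extends continuously to the boundary (`isConnected_halfAnnulus_diff`). So the two punctured
halves are the only possible choice of `U₋` and `U₊`. They are dense in the halves, and their
closures meet in the zero section. Other points of the attractor, such as sinks off the zero section,
may exist but do not matter.
-/

namespace SymplecticBilliard

open Set Filter Topology MeasureTheory
open scoped Pointwise

instance fact_two_pi_pos : Fact (0 < 2 * Real.pi) := ⟨Real.two_pi_pos⟩

/-! ### Dissipative maps of a symmetric annulus -/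

/-- The half `0 < ε s < ψ(t)` of the annulus `|s| < ψ(t)`: upper for `ε = 1`, lower for
`ε = -1`. -/
def halfAnnulus (ψ : Circ → ℝ) (ε : ℝ) : Set (Circ × ℝ) := {p | 0 < ε * p.2 ∧ ε * p.2 < ψ p.1}

/-- The collar `lam ψ(t) ≤ ε s < ψ(t)` of the boundary component `s = ε ψ(t)`. -/
def collar (ψ : Circ → ℝ) (lam ε : ℝ) : Set (Circ × ℝ) :=
  {p | lam * ψ p.1 ≤ ε * p.2 ∧ ε * p.2 < ψ p.1}

/-- The compact annulus `|s| ≤ lam ψ(t)`. -/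
def core (ψ : Circ → ℝ) (lam : ℝ) : Set (Circ × ℝ) := {p | |p.2| ≤ lam * ψ p.1}

/-- The properties of the dissipative billiard map of a Radon domain that determine its Birkhoff
attractor: it embeds the annulus `|s| < ψ(t)` into itself with image `|s| < lam ψ(t)`, respects the
zero section, moves points close to a boundary component close to the corresponding boundary
component of the image, and multiplies the area by `lam`. -/
structure IsDissipativeEmbedding (ψ : Circ → ℝ) (lam : ℝ) (f : Circ × ℝ → Circ × ℝ) : Prop where
  continuous_radius : Continuous ψ
  radius_pos : ∀ t, 0 < ψ t
  lam_mem : lam ∈ Ioo (0 : ℝ) 1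
  continuousOn : ContinuousOn f (annulus (-ψ) ψ)
  injOn : InjOn f (annulus (-ψ) ψ)
  image_eq : f '' annulus (-ψ) ψ = {p | |p.2| < lam * ψ p.1}
  snd_eq_zero_iff : ∀ p ∈ annulus (-ψ) ψ, (f p).2 = 0 ↔ p.2 = 0
  boundary : ∀ ε : ℝ, ε = 1 ∨ ε = -1 →
    ∃ t, (t, ε * (lam * ψ t)) ∈ closure (f '' collar ψ lam ε)
  volume_image : ∀ C ⊆ annulus (-ψ) ψ, IsCompact C →
    volume (f '' C) = ENNReal.ofReal lam * volume C

theorem mem_annulus_neg {ψ : Circ → ℝ} {p : Circ × ℝ} :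
    p ∈ annulus (-ψ) ψ ↔ |p.2| < ψ p.1 := by
  simp only [annulus, mem_ofPred_eq, Pi.neg_apply, abs_lt]

theorem abs_sign_mul {ε : ℝ} (hε : ε = 1 ∨ ε = -1) (x : ℝ) : |ε * x| = |x| := by
  rcases hε with rfl | rfl <;> simp

theorem halfAnnulus_subset {ψ : Circ → ℝ} {ε : ℝ} (hε : ε = 1 ∨ ε = -1) :
    halfAnnulus ψ ε ⊆ annulus (-ψ) ψ := by
  rintro p ⟨h1, h2⟩
  rwa [mem_annulus_neg, ← abs_sign_mul hε, abs_of_pos h1]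

theorem isOpen_halfAnnulus {ψ : Circ → ℝ} (hψ : Continuous ψ) (ε : ℝ) :
    IsOpen (halfAnnulus ψ ε) := by
  have h1 : Continuous fun p : Circ × ℝ => ε * p.2 := by fun_prop
  exact (isOpen_lt continuous_const h1).inter (isOpen_lt h1 (hψ.comp continuous_fst))

theorem disjoint_halfAnnulus (ψ : Circ → ℝ) : Disjoint (halfAnnulus ψ (-1)) (halfAnnulus ψ 1) := by
  rw [Set.disjoint_left]
  rintro p ⟨h1, -⟩ ⟨h2, -⟩
  linarith

theorem isConnected_image_radial {ψ : Circ → ℝ} (hψ : Continuous ψ) (ε : ℝ) {I : Set ℝ}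
    (hI : IsConnected I) :
    IsConnected ((fun q : Circ × ℝ => (q.1, ε * (q.2 * ψ q.1))) '' (univ ×ˢ I)) := by
  have hu : IsConnected (univ : Set Circ) := by
    have := isConnected_univ (α := ℝ) |>.image (fun x : ℝ => (x : Circ))
      (AddCircle.continuous_mk' _).continuousOn
    rwa [image_univ, (QuotientAddGroup.mk_surjective).range_eq] at this
  exact (hu.prod hI).image _ (by fun_prop)

namespace IsDissipativeEmbedding

variable {ψ : Circ → ℝ} {lam : ℝ} {f : Circ × ℝ → Circ × ℝ}

theorem collar_subset (h : IsDissipativeEmbedding ψ lam f) (ε : ℝ) :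
    collar ψ lam ε ⊆ halfAnnulus ψ ε := fun _ hp =>
  ⟨lt_of_lt_of_le (mul_pos h.lam_mem.1 (h.radius_pos _)) hp.1, hp.2⟩

theorem mul_radius_lt (h : IsDissipativeEmbedding ψ lam f) (t : Circ) : lam * ψ t < ψ t := by
  nlinarith [h.radius_pos t, h.lam_mem.2]

theorem isConnected_halfAnnulus (h : IsDissipativeEmbedding ψ lam f) {ε : ℝ}
    (hε : ε = 1 ∨ ε = -1) : IsConnected (halfAnnulus ψ ε) := by
  convert isConnected_image_radial h.continuous_radius ε (isConnected_Ioo (zero_lt_one' ℝ)) using 1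
  have hε2 : ε * ε = 1 := by rcases hε with rfl | rfl <;> norm_num
  ext ⟨t, s⟩
  have ht := h.radius_pos t
  constructor
  · rintro ⟨h1, h2⟩
    refine ⟨(t, ε * s / ψ t), ⟨trivial, div_pos h1 ht, (div_lt_one ht).2 h2⟩, ?_⟩
    simp only [Prod.mk.injEq, true_and]
    rw [div_mul_cancel₀ _ ht.ne', ← mul_assoc, hε2, one_mul]
  · rintro ⟨⟨u, r⟩, ⟨-, h1, h2⟩, he⟩
    obtain ⟨rfl, rfl⟩ := Prod.mk.inj he
    dsimp only at *
    have : ε * (ε * (r * ψ u)) = r * ψ u := by rw [← mul_assoc, hε2, one_mul]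
    refine ⟨?_, ?_⟩
    · rw [this]; positivity
    · rw [this]; nlinarith

theorem isConnected_collar (h : IsDissipativeEmbedding ψ lam f) {ε : ℝ}
    (hε : ε = 1 ∨ ε = -1) : IsConnected (collar ψ lam ε) := by
  convert isConnected_image_radial h.continuous_radius ε (isConnected_Ico h.lam_mem.2) using 1
  have hε2 : ε * ε = 1 := by rcases hε with rfl | rfl <;> norm_num
  ext ⟨t, s⟩
  have ht := h.radius_pos t
  constructor
  · rintro ⟨h1, h2⟩
    refine ⟨(t, ε * s / ψ t), ⟨trivial, (le_div_iff₀ ht).2 h1, (div_lt_one ht).2 h2⟩, ?_⟩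
    simp only [Prod.mk.injEq, true_and]
    rw [div_mul_cancel₀ _ ht.ne', ← mul_assoc, hε2, one_mul]
  · rintro ⟨⟨u, r⟩, ⟨-, h1, h2⟩, he⟩
    obtain ⟨rfl, rfl⟩ := Prod.mk.inj he
    dsimp only at *
    have : ε * (ε * (r * ψ u)) = r * ψ u := by rw [← mul_assoc, hε2, one_mul]
    refine ⟨?_, ?_⟩
    · rw [this]; exact mul_le_mul_of_nonneg_right h1 ht.le
    · rw [this]; nlinarith

theorem image_subset_core (h : IsDissipativeEmbedding ψ lam f) :
    f '' annulus (-ψ) ψ ⊆ core ψ lam := by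
  rw [h.image_eq]
  exact fun p (hp : |p.2| < lam * ψ p.1) => hp.le

theorem core_subset (h : IsDissipativeEmbedding ψ lam f) : core ψ lam ⊆ annulus (-ψ) ψ :=
  fun _ hp => mem_annulus_neg.2 (lt_of_le_of_lt hp (h.mul_radius_lt _))

theorem mapsTo (h : IsDissipativeEmbedding ψ lam f) :
    MapsTo f (annulus (-ψ) ψ) (annulus (-ψ) ψ) := fun _ hp =>
  h.core_subset (h.image_subset_core (mem_image_of_mem f hp))

theorem mem_annulus_zero (h : IsDissipativeEmbedding ψ lam f) (t : Circ) :
    (t, (0 : ℝ)) ∈ annulus (-ψ) ψ := by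
  rw [mem_annulus_neg]; simpa using h.radius_pos t

theorem mem_halfAnnulus_of_ne {p : Circ × ℝ} (hp : p ∈ annulus (-ψ) ψ) (h0 : p.2 ≠ 0) :
    p ∈ halfAnnulus ψ (-1) ∨ p ∈ halfAnnulus ψ 1 := by
  rcases lt_or_gt_of_ne h0 with h1 | h1
  · left; exact ⟨by linarith, by have := hp.1; simp only [Pi.neg_apply] at this; linarith⟩
  · right; exact ⟨by linarith, by have := hp.2; linarith⟩

/-- The image of a half annulus is connected and avoids the zero section, so it lies on one side of
it; the behaviour at the boundary tells on which one. -/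
theorem mapsTo_halfAnnulus (h : IsDissipativeEmbedding ψ lam f) {ε : ℝ} (hε : ε = 1 ∨ ε = -1) :
    MapsTo f (halfAnnulus ψ ε) (halfAnnulus ψ ε) := by
  have hA := halfAnnulus_subset (ψ := ψ) hε
  have hconn : IsPreconnected ((fun p => ε * (f p).2) '' halfAnnulus ψ ε) :=
    (h.isConnected_halfAnnulus hε).isPreconnected.image _
      (continuousOn_const.mul (continuous_snd.comp_continuousOn (h.continuousOn.mono hA)))
  have hε2 : ε * ε = 1 := by rcases hε with rfl | rfl <;> norm_num
  have hε0 : ε ≠ 0 := by rcases hε with rfl | rfl <;> norm_num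
  obtain ⟨t, ht⟩ := h.boundary ε hε
  have hopen : IsOpen {p : Circ × ℝ | 0 < ε * p.2} := isOpen_lt (by fun_prop) (by fun_prop)
  obtain ⟨_, h1, p₀, hp₀, rfl⟩ := mem_closure_iff.1 ht _ hopen
    (by
      change 0 < ε * (ε * (lam * ψ t))
      rw [← mul_assoc, hε2, one_mul]; exact mul_pos h.lam_mem.1 (h.radius_pos t))
  intro p hp
  have hpos : 0 < ε * (f p).2 := by
    by_contra hneg
    obtain ⟨q, hq, hq0⟩ := hconn.ordConnected.out (mem_image_of_mem _ hp)
      (mem_image_of_mem _ (h.collar_subset ε hp₀)) ⟨not_lt.1 hneg, le_of_lt h1⟩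
    have hq2 := (h.snd_eq_zero_iff q (hA hq)).1 ((mul_eq_zero.1 hq0).resolve_left hε0)
    have := hq.1
    rw [hq2] at this
    simp at this
  have := mem_annulus_neg.1 (h.mapsTo (hA hp))
  rw [← abs_sign_mul hε, abs_of_pos hpos] at this
  exact ⟨hpos, this⟩

theorem mem_halfAnnulus_iff (h : IsDissipativeEmbedding ψ lam f) {ε : ℝ} (hε : ε = 1 ∨ ε = -1)
    {p : Circ × ℝ} (hp : p ∈ annulus (-ψ) ψ) : f p ∈ halfAnnulus ψ ε ↔ p ∈ halfAnnulus ψ ε := by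
  refine ⟨fun hf => ?_, fun h1 => h.mapsTo_halfAnnulus hε h1⟩
  by_cases h0 : p.2 = 0
  · have := hf.1
    rw [(h.snd_eq_zero_iff p hp).2 h0] at this
    simp at this
  have hd := Set.disjoint_left.1 (disjoint_halfAnnulus ψ)
  rcases mem_halfAnnulus_of_ne hp h0 with h1 | h1 <;> rcases hε with rfl | rfl
  · exact absurd hf (hd (h.mapsTo_halfAnnulus (Or.inr rfl) h1))
  · exact h1
  · exact h1
  · exact absurd (h.mapsTo_halfAnnulus (Or.inl rfl) h1) (hd hf)

theorem iterate_mapsTo (h : IsDissipativeEmbedding ψ lam f) (n : ℕ) :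
    MapsTo f^[n] (annulus (-ψ) ψ) (annulus (-ψ) ψ) := h.mapsTo.iterate n

theorem iterate_injOn (h : IsDissipativeEmbedding ψ lam f) (n : ℕ) :
    InjOn f^[n] (annulus (-ψ) ψ) := h.injOn.iterate h.mapsTo n

theorem iterate_continuousOn (h : IsDissipativeEmbedding ψ lam f) (n : ℕ) :
    ContinuousOn f^[n] (annulus (-ψ) ψ) := h.continuousOn.iterate h.mapsTo n

theorem iterate_mem_halfAnnulus_iff (h : IsDissipativeEmbedding ψ lam f) {ε : ℝ}
    (hε : ε = 1 ∨ ε = -1) (n : ℕ) {p : Circ × ℝ} (hp : p ∈ annulus (-ψ) ψ) :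
    f^[n] p ∈ halfAnnulus ψ ε ↔ p ∈ halfAnnulus ψ ε := by
  induction n with
  | zero => rfl
  | succ n ih =>
    rw [Function.iterate_succ_apply', h.mem_halfAnnulus_iff hε (h.iterate_mapsTo n hp), ih]

theorem attractor_subset_image_core (h : IsDissipativeEmbedding ψ lam f) (n : ℕ) :
    attractor f (annulus (-ψ) ψ) ⊆ f^[n] '' core ψ lam := by
  intro p hp
  obtain ⟨q, hq, rfl⟩ := mem_iInter.1 hp (n + 1)
  exact ⟨f q, h.image_subset_core (mem_image_of_mem f hq), rfl⟩

/-- The attractor does not change if the open annulus is replaced by the compact core. -/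
theorem attractor_eq (h : IsDissipativeEmbedding ψ lam f) :
    attractor f (annulus (-ψ) ψ) = ⋂ n : ℕ, f^[n] '' core ψ lam :=
  Subset.antisymm (subset_iInter h.attractor_subset_image_core)
    (iInter_mono fun _ => image_mono h.core_subset)

theorem isCompact_core (h : IsDissipativeEmbedding ψ lam f) : IsCompact (core ψ lam) := by
  have hc := h.continuous_radius
  obtain ⟨M, hM⟩ := (isCompact_range hc).bddAbove
  refine ((isCompact_univ (X := Circ)).prod (isCompact_Icc (a := -(lam * M)) (b := lam * M)))
    |>.of_isClosed_subset (isClosed_le (by fun_prop) (by fun_prop)) ?_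
  intro p hp
  have h1 : lam * ψ p.1 ≤ lam * M :=
    mul_le_mul_of_nonneg_left (hM (mem_range_self _)) h.lam_mem.1.le
  exact ⟨trivial, abs_le.1 (le_trans hp h1)⟩

theorem isCompact_iterate_core (h : IsDissipativeEmbedding ψ lam f) (n : ℕ) :
    IsCompact (f^[n] '' core ψ lam) :=
  h.isCompact_core.image_of_continuousOn ((h.iterate_continuousOn n).mono h.core_subset)

theorem isClosed_attractor (h : IsDissipativeEmbedding ψ lam f) :
    IsClosed (attractor f (annulus (-ψ) ψ)) := by
  rw [h.attractor_eq]
  exact isClosed_iInter fun n => (h.isCompact_iterate_core n).isClosed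

theorem volume_iterate_core (h : IsDissipativeEmbedding ψ lam f) (n : ℕ) :
    volume (f^[n] '' core ψ lam) = ENNReal.ofReal lam ^ n * volume (core ψ lam) := by
  induction n with
  | zero => simp
  | succ n ih =>
    rw [Function.iterate_succ', image_comp, h.volume_image _ _ (h.isCompact_iterate_core n), ih,
      pow_succ', mul_assoc]
    exact image_subset_iff.2 fun p hp => h.iterate_mapsTo n (h.core_subset hp)

theorem volume_attractor (h : IsDissipativeEmbedding ψ lam f) :
    volume (attractor f (annulus (-ψ) ψ)) = 0 := by
  have hlim : Tendsto (fun n : ℕ => ENNReal.ofReal lam ^ n * volume (core ψ lam)) atTop (𝓝 0) := by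
    have h1 : ENNReal.ofReal lam < 1 := by
      rw [← ENNReal.ofReal_one]; exact (ENNReal.ofReal_lt_ofReal_iff one_pos).2 h.lam_mem.2
    have := ENNReal.Tendsto.mul_const (ENNReal.tendsto_pow_atTop_nhds_zero_of_lt_one h1)
      (Or.inr h.isCompact_core.measure_lt_top.ne : (0 : ENNReal) ≠ 0 ∨ volume (core ψ lam) ≠ ⊤)
    rwa [zero_mul] at this
  refine le_antisymm (ge_of_tendsto' hlim fun n => ?_) (bot_le)
  rw [← h.volume_iterate_core n]
  exact measure_mono (h.attractor_subset_image_core n)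

theorem interior_attractor (h : IsDissipativeEmbedding ψ lam f) :
    interior (attractor f (annulus (-ψ) ψ)) = ∅ :=
  Measure.interior_eq_empty_of_null h.volume_attractor

theorem zero_mem_attractor (h : IsDissipativeEmbedding ψ lam f) (t : Circ) :
    (t, (0 : ℝ)) ∈ attractor f (annulus (-ψ) ψ) := by
  refine mem_iInter.2 fun n => ?_
  suffices ∀ t : Circ, ∃ u : Circ, f^[n] (u, 0) = (t, 0) by
    obtain ⟨u, hu⟩ := this t
    exact ⟨_, h.mem_annulus_zero u, hu⟩
  induction n with
  | zero => exact fun t => ⟨t, rfl⟩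
  | succ n ih =>
    intro t
    obtain ⟨u, hu⟩ := ih t
    have : (u, (0 : ℝ)) ∈ f '' annulus (-ψ) ψ := by
      rw [h.image_eq]
      simpa using mul_pos h.lam_mem.1 (h.radius_pos u)
    obtain ⟨⟨w, s⟩, hq, hqu⟩ := this
    obtain rfl : s = 0 := (h.snd_eq_zero_iff _ hq).1 (by rw [hqu])
    exact ⟨w, by rw [Function.iterate_succ_apply, hqu, hu]⟩

theorem iterate_collar_subset (h : IsDissipativeEmbedding ψ lam f) {ε : ℝ}
    (hε : ε = 1 ∨ ε = -1) (k : ℕ) :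
    f^[k] '' collar ψ lam ε ⊆ halfAnnulus ψ ε \ attractor f (annulus (-ψ) ψ) := by
  have hcA : collar ψ lam ε ⊆ annulus (-ψ) ψ := (h.collar_subset ε).trans (halfAnnulus_subset hε)
  rintro _ ⟨q, hq, rfl⟩
  refine ⟨(h.iterate_mem_halfAnnulus_iff hε k (hcA hq)).2 (h.collar_subset ε hq), fun hatt => ?_⟩
  obtain ⟨r, hr, hrq⟩ := mem_iInter.1 hatt (k + 1)
  rw [Function.iterate_succ_apply] at hrq
  have h1 : q ∈ f '' annulus (-ψ) ψ := ⟨r, hr, h.iterate_injOn k (h.mapsTo hr) (hcA hq) hrq⟩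
  rw [h.image_eq] at h1
  have h2 : |q.2| < lam * ψ q.1 := h1
  rw [← abs_sign_mul hε] at h2
  exact absurd (lt_of_le_of_lt (le_abs_self _) h2) (not_lt.2 hq.1)

/-- Each iterate of a collar, together with the next one, is connected; these sets form a chain
that exhausts the part of the half annulus outside the attractor. -/
theorem isConnected_halfAnnulus_diff (h : IsDissipativeEmbedding ψ lam f) {ε : ℝ}
    (hε : ε = 1 ∨ ε = -1) :
    IsConnected (halfAnnulus ψ ε \ attractor f (annulus (-ψ) ψ)) := by
  have hcA : collar ψ lam ε ⊆ annulus (-ψ) ψ := (h.collar_subset ε).trans (halfAnnulus_subset hε)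
  have hcoll := h.isConnected_collar hε
  have hfcoll : IsConnected (f '' collar ψ lam ε) := hcoll.image _ (h.continuousOn.mono hcA)
  obtain ⟨t, ht⟩ := h.boundary ε hε
  have hε2 : ε * ε = 1 := by rcases hε with rfl | rfl <;> norm_num
  have htc : (t, ε * (lam * ψ t)) ∈ collar ψ lam ε := by
    have : ε * (ε * (lam * ψ t)) = lam * ψ t := by rw [← mul_assoc, hε2, one_mul]
    exact ⟨this.ge, this.trans_lt (h.mul_radius_lt t)⟩
  set V : Set (Circ × ℝ) := collar ψ lam ε ∪ f '' collar ψ lam ε with hV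
  have hVA : V ⊆ annulus (-ψ) ψ := union_subset hcA ((image_mono hcA).trans h.mapsTo.image_subset)
  have hVconn : IsConnected V := by
    have h1 : IsConnected (insert (t, ε * (lam * ψ t)) (f '' collar ψ lam ε)) :=
      hfcoll.subset_closure (subset_insert _ _) (insert_subset ht subset_closure)
    convert hcoll.union ⟨_, htc, mem_insert _ _⟩ h1 using 1
    rw [union_insert, ← hV, insert_eq_of_mem (show _ ∈ V from Or.inl htc)]
  have hchain : IsConnected (⋃ k : ℕ, f^[k] '' V) := by
    refine IsConnected.iUnion_of_chain
      (fun k => hVconn.image _ ((h.iterate_continuousOn k).mono hVA)) fun k => ?_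
    obtain ⟨q, hq⟩ := hcoll.nonempty
    exact ⟨f^[k] (f q), mem_image_of_mem _ (Or.inr (mem_image_of_mem f hq)),
      ⟨q, Or.inl hq, Function.iterate_succ_apply f k q⟩⟩
  convert hchain using 1
  refine Subset.antisymm ?_ (iUnion_subset fun k => ?_)
  · rintro p ⟨hp, hpatt⟩
    classical
    have hex : ∃ n : ℕ, p ∉ f^[n] '' annulus (-ψ) ψ := by
      by_contra! hall
      exact hpatt (mem_iInter.2 hall)
    -- the first exit time from the nested images is positive
    obtain ⟨m, hm⟩ : ∃ m, Nat.find hex = m + 1 := by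
      refine Nat.exists_eq_succ_of_ne_zero fun h0 => Nat.find_spec hex ?_
      rw [h0]
      exact ⟨p, halfAnnulus_subset hε hp, rfl⟩
    obtain ⟨q, hq, rfl⟩ : p ∈ f^[m] '' annulus (-ψ) ψ := by
      by_contra hc
      exact Nat.find_min hex (by omega) hc
    have hq' : q ∈ halfAnnulus ψ ε := (h.iterate_mem_halfAnnulus_iff hε m hq).1 hp
    have hqf : q ∉ f '' annulus (-ψ) ψ := by
      rintro ⟨r, hr, rfl⟩
      refine Nat.find_spec hex ?_
      rw [hm]
      exact ⟨r, hr, rfl⟩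
    rw [h.image_eq] at hqf
    have h2 : ¬ |q.2| < lam * ψ q.1 := hqf
    rw [← abs_sign_mul hε, abs_of_pos hq'.1] at h2
    exact mem_iUnion.2 ⟨m, q, Or.inl ⟨not_lt.1 h2, hq'.2⟩, rfl⟩
  · rw [hV, image_union, ← image_comp, ← Function.iterate_succ]
    exact union_subset (h.iterate_collar_subset hε k) (h.iterate_collar_subset hε (k + 1))

theorem mem_closure_collar (h : IsDissipativeEmbedding ψ lam f) {ε : ℝ}
    (hε : ε = 1 ∨ ε = -1) (t : Circ) : (t, ε * ψ t) ∈ closure (collar ψ lam ε) := by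
  have hcont : Continuous fun r : ℝ => ((t, ε * (r * ψ t)) : Circ × ℝ) := by fun_prop
  have h1 : (1 : ℝ) ∈ closure (Ico lam 1) := by
    rw [closure_Ico h.lam_mem.2.ne]; exact right_mem_Icc.2 h.lam_mem.2.le
  have hε2 : ε * ε = 1 := by rcases hε with rfl | rfl <;> norm_num
  have hmaps : MapsTo (fun r : ℝ => ((t, ε * (r * ψ t)) : Circ × ℝ)) (Ico lam 1)
      (collar ψ lam ε) := by
    intro r hr
    have : ε * (ε * (r * ψ t)) = r * ψ t := by rw [← mul_assoc, hε2, one_mul]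
    have ht := h.radius_pos t
    refine ⟨?_, ?_⟩
    · change _ ≤ ε * (ε * (r * ψ t))
      rw [this]; exact mul_le_mul_of_nonneg_right hr.1 ht.le
    · change ε * (ε * (r * ψ t)) < _
      rw [this]; nlinarith [hr.2]
  simpa using hmaps.closure hcont h1

/-- Since the attractor has empty interior, removing it from a half annulus does not change the
closure. -/
theorem closure_halfAnnulus_diff (h : IsDissipativeEmbedding ψ lam f) (ε : ℝ) :
    closure (halfAnnulus ψ ε \ attractor f (annulus (-ψ) ψ)) = closure (halfAnnulus ψ ε) := by
  have hd : Dense (attractor f (annulus (-ψ) ψ))ᶜ :=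
    interior_eq_empty_iff_dense_compl.1 h.interior_attractor
  refine Subset.antisymm (closure_mono sdiff_subset) (closure_minimal ?_ isClosed_closure)
  exact hd.open_subset_closure_inter (isOpen_halfAnnulus h.continuous_radius ε)

theorem closure_halfAnnulus_subset (ε : ℝ) :
    closure (halfAnnulus ψ ε) ⊆ {p : Circ × ℝ | 0 ≤ ε * p.2} :=
  closure_minimal (fun _ hp => le_of_lt hp.1) (isClosed_le continuous_const (by fun_prop))

theorem zero_mem_closure_halfAnnulus (h : IsDissipativeEmbedding ψ lam f) {ε : ℝ}
    (hε : ε = 1 ∨ ε = -1) (t : Circ) : (t, (0 : ℝ)) ∈ closure (halfAnnulus ψ ε) := by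
  have hcont : Continuous fun r : ℝ => ((t, ε * (r * ψ t)) : Circ × ℝ) := by fun_prop
  have h1 : (0 : ℝ) ∈ closure (Ioo (0 : ℝ) 1) := by
    rw [closure_Ioo zero_ne_one]; exact left_mem_Icc.2 zero_le_one
  have hε2 : ε * ε = 1 := by rcases hε with rfl | rfl <;> norm_num
  have hmaps : MapsTo (fun r : ℝ => ((t, ε * (r * ψ t)) : Circ × ℝ)) (Ioo 0 1)
      (halfAnnulus ψ ε) := by
    intro r hr
    have : ε * (ε * (r * ψ t)) = r * ψ t := by rw [← mul_assoc, hε2, one_mul]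
    have ht := h.radius_pos t
    refine ⟨?_, ?_⟩
    · change _ < ε * (ε * (r * ψ t))
      rw [this]; exact mul_pos hr.1 ht
    · change ε * (ε * (r * ψ t)) < _
      rw [this]; nlinarith [hr.2]
  simpa using hmaps.closure hcont h1

theorem closure_inter_closure (h : IsDissipativeEmbedding ψ lam f) :
    closure (halfAnnulus ψ (-1) \ attractor f (annulus (-ψ) ψ)) ∩
      closure (halfAnnulus ψ 1 \ attractor f (annulus (-ψ) ψ)) = univ ×ˢ {(0 : ℝ)} := by
  rw [h.closure_halfAnnulus_diff, h.closure_halfAnnulus_diff]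
  ext ⟨t, s⟩
  constructor
  · rintro ⟨h1, h2⟩
    have h1' := closure_halfAnnulus_subset _ h1
    have h2' := closure_halfAnnulus_subset _ h2
    simp only [mem_ofPred_eq] at h1' h2'
    exact ⟨trivial, mem_singleton_iff.2 (by linarith)⟩
  · rintro ⟨-, hs⟩
    obtain rfl : s = 0 := hs
    exact ⟨h.zero_mem_closure_halfAnnulus (Or.inr rfl) t,
      h.zero_mem_closure_halfAnnulus (Or.inl rfl) t⟩

theorem annulus_diff_attractor (h : IsDissipativeEmbedding ψ lam f) :
    annulus (-ψ) ψ \ attractor f (annulus (-ψ) ψ) =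
      (halfAnnulus ψ (-1) \ attractor f (annulus (-ψ) ψ)) ∪
        (halfAnnulus ψ 1 \ attractor f (annulus (-ψ) ψ)) := by
  rw [← union_sdiff_distrib]
  ext ⟨t, s⟩
  refine and_congr_left fun hatt => ⟨fun hp => mem_halfAnnulus_of_ne hp ?_, ?_⟩
  · rintro rfl
    exact hatt (h.zero_mem_attractor t)
  · rintro (hp | hp)
    · exact halfAnnulus_subset (Or.inr rfl) hp
    · exact halfAnnulus_subset (Or.inl rfl) hp

theorem graph_subset_frontier (h : IsDissipativeEmbedding ψ lam f) {ε : ℝ}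
    (hε : ε = 1 ∨ ε = -1) (t : Circ) :
    (t, ε * ψ t) ∈ frontier (halfAnnulus ψ ε \ attractor f (annulus (-ψ) ψ)) := by
  have hε2 : ε * ε = 1 := by rcases hε with rfl | rfl <;> norm_num
  have hop : IsOpen (halfAnnulus ψ ε \ attractor f (annulus (-ψ) ψ)) :=
    (isOpen_halfAnnulus h.continuous_radius ε).sdiff h.isClosed_attractor
  rw [hop.frontier_eq]
  refine ⟨closure_mono (by simpa using h.iterate_collar_subset hε 0)
    (h.mem_closure_collar hε t), fun hm => ?_⟩
  have := hm.1.2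
  simp only [← mul_assoc, hε2, one_mul, lt_irrefl] at this

/-- The only Birkhoff attractor of a dissipative embedding is the zero section. A component of the
complement of the attractor avoids the zero section, hence lies in one of the two half annuli, so
that the two components in the definition can only be the two punctured half annuli. -/
theorem isBirkhoffAttractor_iff (h : IsDissipativeEmbedding ψ lam f) (Λ : Set (Circ × ℝ)) :
    IsBirkhoffAttractor (-ψ) ψ f Λ ↔ Λ = univ ×ˢ {(0 : ℝ)} := by
  constructor
  · rintro ⟨Um, Up, -, -, hUm, hUp, hdisj, hunion, hgm, hgp, rfl⟩
    rw [h.annulus_diff_attractor] at hunion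
    have hsep : ∀ U : Set (Circ × ℝ), U ⊆ Um ∪ Up → IsConnected U →
        U ⊆ halfAnnulus ψ (-1) ∨ U ⊆ halfAnnulus ψ 1 := by
      intro U hU hconn
      refine isPreconnected_iff_subset_of_disjoint.1 hconn.isPreconnected _ _
        (isOpen_halfAnnulus h.continuous_radius _) (isOpen_halfAnnulus h.continuous_radius _)
        ?_ ?_
      · refine (hU.trans hunion.subset).trans ?_
        exact union_subset_union sdiff_subset sdiff_subset
      · rw [(disjoint_halfAnnulus ψ).inter_eq, inter_empty]
    have hm : Um ⊆ halfAnnulus ψ (-1) := by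
      refine (hsep Um subset_union_left hUm).resolve_right fun hc => ?_
      have h1 : ((0 : Circ), (-ψ) 0) ∈ closure (halfAnnulus ψ 1) :=
        closure_mono hc (frontier_subset_closure (hgm rfl))
      have h2 := closure_halfAnnulus_subset _ h1
      simp only [mem_ofPred_eq, Pi.neg_apply] at h2
      linarith [h.radius_pos 0]
    have hp : Up ⊆ halfAnnulus ψ 1 := by
      refine (hsep Up subset_union_right hUp).resolve_left fun hc => ?_
      have h1 : ((0 : Circ), ψ 0) ∈ closure (halfAnnulus ψ (-1)) :=
        closure_mono hc (frontier_subset_closure (hgp rfl))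
      have h2 := closure_halfAnnulus_subset _ h1
      simp only [mem_ofPred_eq] at h2
      linarith [h.radius_pos 0]
    have hd := Set.disjoint_left.1 (disjoint_halfAnnulus ψ)
    have hUm_eq : Um = halfAnnulus ψ (-1) \ attractor f (annulus (-ψ) ψ) := by
      refine Subset.antisymm (fun x hx => ?_) (fun x hx => ?_)
      · exact (hunion.subset (Or.inl hx)).resolve_right fun hc => hd (hm hx) hc.1
      · exact (hunion.superset (Or.inl hx)).resolve_right fun hc => hd hx.1 (hp hc)
    have hUp_eq : Up = halfAnnulus ψ 1 \ attractor f (annulus (-ψ) ψ) := by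
      refine Subset.antisymm (fun x hx => ?_) (fun x hx => ?_)
      · exact (hunion.subset (Or.inr hx)).resolve_left fun hc => hd hc.1 (hp hx)
      · exact (hunion.superset (Or.inr hx)).resolve_left fun hc => hd (hm hc) hx.1
    rw [hUm_eq, hUp_eq, h.closure_inter_closure]
  · rintro rfl
    refine ⟨_, _, (isOpen_halfAnnulus h.continuous_radius (-1)).sdiff h.isClosed_attractor,
      (isOpen_halfAnnulus h.continuous_radius 1).sdiff h.isClosed_attractor,
      h.isConnected_halfAnnulus_diff (Or.inr rfl), h.isConnected_halfAnnulus_diff (Or.inl rfl),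
      (disjoint_halfAnnulus ψ).mono sdiff_subset sdiff_subset, h.annulus_diff_attractor.symm, ?_, ?_,
      h.closure_inter_closure.symm⟩
    · rintro ⟨t, s⟩ hs
      obtain rfl : s = -ψ t := hs
      simpa using h.graph_subset_frontier (Or.inr rfl) t
    · rintro ⟨t, s⟩ hs
      obtain rfl : s = ψ t := hs
      simpa using h.graph_subset_frontier (Or.inl rfl) t

end IsDissipativeEmbedding

/-! ### The determinant form -/

section Det

variable (u v w : Plane) (c : ℝ)

theorem det2_self : det2 u u = 0 := by simp only [det2]; ring

theorem det2_comm : det2 u v = -det2 v u := by simp only [det2]; ring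

@[simp] theorem det2_neg_left : det2 (-u) v = -det2 u v := by
  simp only [det2, PiLp.neg_apply]; ring

@[simp] theorem det2_neg_right : det2 u (-v) = -det2 u v := by
  simp only [det2, PiLp.neg_apply]; ring

@[simp] theorem det2_smul_left : det2 (c • u) v = c * det2 u v := by
  simp only [det2, PiLp.smul_apply, smul_eq_mul]; ring

@[simp] theorem det2_smul_right : det2 u (c • v) = c * det2 u v := by
  simp only [det2, PiLp.smul_apply, smul_eq_mul]; ring

theorem det2_sub_right : det2 u (v - w) = det2 u v - det2 u w := by
  simp only [det2, PiLp.sub_apply]; ring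

theorem det2_add_right : det2 u (v + w) = det2 u v + det2 u w := by
  simp only [det2, PiLp.add_apply]; ring

end Det

theorem exists_eq_smul_of_det2_eq_zero {u v : Plane} (hu : u ≠ 0) (h : det2 u v = 0) :
    ∃ c : ℝ, v = c • u := by
  simp only [det2] at h
  by_cases h0 : u 0 = 0
  · have h1 : u 1 ≠ 0 := fun h1 => hu (by ext i; fin_cases i <;> simp [h0, h1])
    refine ⟨v 1 / u 1, ?_⟩
    ext i
    fin_cases i
    · simp only [h0, zero_mul, zero_sub, neg_eq_zero, mul_eq_zero, h1, false_or] at h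
      simp [h, h0]
    · simp [h1]
  · refine ⟨v 0 / u 0, ?_⟩
    ext i
    fin_cases i
    · simp [h0]
    · simp only [PiLp.smul_apply, smul_eq_mul, Fin.mk_one]
      field_simp
      linarith

theorem continuous_det2 : Continuous fun p : Plane × Plane => det2 p.1 p.2 := by
  unfold det2; fun_prop

theorem hasDerivAt_det2 {f : ℝ → Plane} {f' : Plane} {x : ℝ} (w : Plane)
    (h : HasDerivAt f f' x) : HasDerivAt (fun y => det2 w (f y)) (det2 w f') x := by
  have hi : ∀ i, HasDerivAt (fun y => f y i) (f' i) x := fun i =>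
    (EuclideanSpace.proj (𝕜 := ℝ) i).hasFDerivAt.comp_hasDerivAt x h
  exact ((hi 1).const_mul (w 0)).sub ((hi 0).const_mul (w 1))

/-! ### Centrally symmetric ovals -/

/-- The determinant of the tangent vectors at `t` and `u`. -/
noncomputable def tangentDet (γ : Circ → Plane) (t u : Circ) : ℝ :=
  det2 (velocity γ t) (velocity γ u)

/-- The coordinate `-det(γ'(t), γ(u) - O)` of the pair `(t, u)`. -/
noncomputable def height (γ : Circ → Plane) (O : Plane) (t u : Circ) : ℝ :=
  -det2 (velocity γ t) (γ u - O)

/-- The properties of a regular parametrization of the boundary of a centrally symmetric strictly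
convex domain, of class `C¹`, that involve the curve alone: `supporting` says that the curve is to
the left of each tangent line, and touches it only once. -/
structure IsSymmetricOval (γ : Circ → Plane) (O : Plane) : Prop where
  hasDerivAt : ∀ x : ℝ, HasDerivAt (fun y : ℝ => γ y) (velocity γ x) x
  continuous : Continuous γ
  continuous_velocity : Continuous (velocity γ)
  height_self_pos : ∀ t, 0 < height γ O t t
  supporting : ∀ t u, t ≠ u → 0 < det2 (velocity γ t) (γ u - γ t)
  exists_antipode : ∀ t, ∃ u, γ u - O = -(γ t - O)

theorem tangentDet_comm (γ : Circ → Plane) (t u : Circ) : tangentDet γ t u = -tangentDet γ u t :=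
  det2_comm _ _

theorem height_sub_height (γ : Circ → Plane) (O : Plane) (t u w : Circ) :
    height γ O t u - height γ O t w = -det2 (velocity γ t) (γ u - γ w) := by
  simp only [height, det2_sub_right]; ring

namespace IsSymmetricOval

variable {γ : Circ → Plane} {O : Plane}

theorem velocity_ne_zero (h : IsSymmetricOval γ O) (t : Circ) : velocity γ t ≠ 0 := fun h0 => by
  have := h.height_self_pos t
  simp [height, h0, det2] at this

theorem hasDerivAt_height (h : IsSymmetricOval γ O) (t : Circ) (x : ℝ) :
    HasDerivAt (fun y : ℝ => height γ O t y) (-tangentDet γ t x) x :=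
  (hasDerivAt_det2 (velocity γ t) ((h.hasDerivAt x).sub_const O)).neg

theorem continuous_height (h : IsSymmetricOval γ O) :
    Continuous fun p : Circ × Circ => height γ O p.1 p.2 :=
  (continuous_det2.comp (((h.continuous_velocity.comp continuous_fst)).prodMk
    ((h.continuous.comp continuous_snd).sub continuous_const))).neg

theorem continuous_tangentDet (h : IsSymmetricOval γ O) :
    Continuous fun p : Circ × Circ => tangentDet γ p.1 p.2 :=
  continuous_det2.comp ((h.continuous_velocity.comp continuous_fst).prodMk
    (h.continuous_velocity.comp continuous_snd))

/-- The tangent at the antipodal point is parallel: the antipodal point is the farthest from the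
tangent line. -/
theorem tangentDet_antipode (h : IsSymmetricOval γ O) {t u : Circ}
    (hu : γ u - O = -(γ t - O)) : tangentDet γ t u = 0 := by
  obtain ⟨x, rfl⟩ := QuotientAddGroup.mk_surjective u
  have hmin : IsLocalMin (fun y : ℝ => height γ O t y) x := by
    refine Filter.Eventually.of_forall fun y => ?_
    obtain ⟨w, hw⟩ := h.exists_antipode y
    have h1 : 0 ≤ det2 (velocity γ t) (γ w - γ t) := by
      rcases eq_or_ne t w with rfl | hne
      · simp [det2]
      · exact (h.supporting t w hne).le
    have h2 : γ w - γ t = (γ x - O) - (γ y - O) := by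
      rw [show γ w - γ t = (γ w - O) - (γ t - O) by abel, hw]
      have : γ (x : Circ) - O = -(γ t - O) := hu
      rw [this]; abel
    rw [h2, det2_sub_right] at h1
    change -_ ≤ -_
    linarith
  have := hmin.hasDerivAt_eq_zero (h.hasDerivAt_height t x)
  exact neg_eq_zero.1 this

theorem antipode_ne (h : IsSymmetricOval γ O) {t u : Circ}
    (hu : γ u - O = -(γ t - O)) : u ≠ t := by
  rintro rfl
  have h0 : γ u - O = 0 := by
    have : (2 : ℝ) • (γ u - O) = 0 := by rw [two_smul]; nth_rewrite 1 [hu]; exact neg_add_cancel _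
    exact (smul_eq_zero.1 this).resolve_left two_ne_zero
  have := h.height_self_pos u
  simp [height, h0, det2] at this

theorem exists_velocity_eq_smul (h : IsSymmetricOval γ O) {t u : Circ} (hut : u ≠ t)
    (hd : tangentDet γ t u = 0) : ∃ c : ℝ, 0 < c ∧ velocity γ u = -(c • velocity γ t) := by
  obtain ⟨c, hc⟩ := exists_eq_smul_of_det2_eq_zero (h.velocity_ne_zero t) hd
  refine ⟨-c, ?_, by rw [hc]; simp⟩
  have h1 := h.supporting t u hut.symm
  have h2 := h.supporting u t hut
  rw [hc, det2_smul_left, ← neg_sub (γ u) (γ t), det2_neg_right] at h2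
  by_contra hneg
  nlinarith

theorem eq_of_tangentDet_eq_zero (h : IsSymmetricOval γ O) {t u w : Circ}
    (hu : γ u - O = -(γ t - O)) (hw : w ≠ t) (hd : tangentDet γ t w = 0) : w = u := by
  by_contra hne
  obtain ⟨c, hc, hcw⟩ := h.exists_velocity_eq_smul hw hd
  obtain ⟨b, hb, hbu⟩ := h.exists_velocity_eq_smul (h.antipode_ne hu) (h.tangentDet_antipode hu)
  have h1 := h.supporting w u hne
  have h2 := h.supporting u w (Ne.symm hne)
  rw [hcw, det2_neg_left, det2_smul_left] at h1
  rw [hbu, det2_neg_left, det2_smul_left, ← neg_sub (γ u) (γ w), det2_neg_right] at h2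
  rw [mul_neg, neg_neg] at h2
  have h3 := pos_of_mul_pos_right h2 hb.le
  linarith [mul_pos hc h3]

theorem opposite_spec (h : IsSymmetricOval γ O) (t : Circ) :
    γ (opposite γ t) - O = -(γ t - O) := by
  obtain ⟨u, hu⟩ := h.exists_antipode t
  have h1 : opposite γ t ≠ t ∧ det2 (velocity γ t) (velocity γ (opposite γ t)) = 0 :=
    Classical.epsilon_spec (p := fun u => u ≠ t ∧ det2 (velocity γ t) (velocity γ u) = 0)
      ⟨u, h.antipode_ne hu, h.tangentDet_antipode hu⟩
  rw [h.eq_of_tangentDet_eq_zero hu h1.1 h1.2, hu]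

theorem opposite_ne (h : IsSymmetricOval γ O) (t : Circ) : opposite γ t ≠ t :=
  h.antipode_ne (h.opposite_spec t)

theorem tangentDet_eq_zero_iff (h : IsSymmetricOval γ O) {t u : Circ} :
    tangentDet γ t u = 0 ↔ u = t ∨ u = opposite γ t := by
  constructor
  · intro hd
    by_cases hut : u = t
    · exact Or.inl hut
    · exact Or.inr (h.eq_of_tangentDet_eq_zero (h.opposite_spec t) hut hd)
  · rintro (rfl | rfl)
    · exact det2_self _
    · exact h.tangentDet_antipode (h.opposite_spec t)

theorem injective (h : IsSymmetricOval γ O) : Function.Injective γ := by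
  intro t u htu
  by_contra hne
  have := h.supporting t u hne
  simp [htu, det2] at this

theorem opposite_opposite (h : IsSymmetricOval γ O) (t : Circ) :
    opposite γ (opposite γ t) = t := by
  apply h.injective
  have h1 := h.opposite_spec (opposite γ t)
  rw [h.opposite_spec t, neg_neg] at h1
  exact sub_left_injective h1

theorem height_opposite_right (h : IsSymmetricOval γ O) (t u : Circ) :
    height γ O t (opposite γ u) = -height γ O t u := by
  rw [height, height, h.opposite_spec, det2_neg_right]

theorem exists_velocity_opposite (h : IsSymmetricOval γ O) (t : Circ) :
    ∃ c : ℝ, 0 < c ∧ velocity γ (opposite γ t) = -(c • velocity γ t) :=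
  h.exists_velocity_eq_smul (h.opposite_ne t) (h.tangentDet_antipode (h.opposite_spec t))

theorem tangentDet_opposite_right_pos_iff (h : IsSymmetricOval γ O) (t u : Circ) :
    0 < tangentDet γ t (opposite γ u) ↔ 0 < tangentDet γ u t := by
  obtain ⟨c, hc, hcv⟩ := h.exists_velocity_opposite u
  rw [tangentDet_comm γ u t, tangentDet, hcv, det2_neg_right, det2_smul_right, ← mul_neg]
  exact mul_pos_iff_of_pos_left hc

theorem tangentDet_opposite_right_nonneg_iff (h : IsSymmetricOval γ O) (t u : Circ) :
    0 ≤ tangentDet γ t (opposite γ u) ↔ 0 ≤ tangentDet γ u t := by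
  obtain ⟨c, hc, hcv⟩ := h.exists_velocity_opposite u
  rw [tangentDet_comm γ u t, tangentDet, hcv, det2_neg_right, det2_smul_right, ← mul_neg]
  exact mul_nonneg_iff_of_pos_left hc

/-! ### Lifts to the real line -/

theorem coe_ne_coe_of_mem_Ioo {x z : ℝ} (hz : z ∈ Ioo x (x + 2 * Real.pi)) :
    (z : Circ) ≠ (x : Circ) := fun he =>
  hz.1.ne' ((AddCircle.coe_eq_coe_iff_of_mem_Ico (p := 2 * Real.pi) (Ioo_subset_Ico_self hz)
    (left_mem_Ico.2 (by linarith [hz.1, hz.2]))).1 he)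

theorem exists_lift (x : ℝ) (t : Circ) : ∃ z ∈ Ico x (x + 2 * Real.pi), (z : Circ) = t := by
  have : t ∈ ((↑) : ℝ → Circ) '' Ico x (x + 2 * Real.pi) := by
    rw [AddCircle.coe_image_Ico_eq]; trivial
  exact this

theorem sign_of_lift (h : IsSymmetricOval γ O) {x y : ℝ} (hxy : x < y)
    (hy : y < x + 2 * Real.pi) (hyo : (y : Circ) = opposite γ x) :
    (∀ z ∈ Ioo x y, 0 < tangentDet γ x z) ∧
      ∀ z ∈ Ioo y (x + 2 * Real.pi), tangentDet γ x z < 0 := by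
  have hcD : Continuous fun z : ℝ => tangentDet γ x z :=
    h.continuous_tangentDet.comp (continuous_const.prodMk (AddCircle.continuous_mk' _))
  have hH := h.hasDerivAt_height (x : Circ)
  have hcH : Continuous fun z : ℝ => height γ O x z :=
    continuous_iff_continuousAt.2 fun z => (hH z).continuousAt
  have hne : ∀ z ∈ Ioo x (x + 2 * Real.pi), z ≠ y → tangentDet γ x z ≠ 0 := by
    intro z hz hzy h0
    rcases h.tangentDet_eq_zero_iff.1 h0 with h1 | h1
    · exact coe_ne_coe_of_mem_Ioo hz h1
    · rw [← hyo] at h1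
      exact hzy ((AddCircle.coe_eq_coe_iff_of_mem_Ico (p := 2 * Real.pi)
        (Ioo_subset_Ico_self hz) ⟨hxy.le, hy⟩).1 h1)
  -- the height of `y` is below the common height of the two ends of the period
  have hlt : height γ O x y < height γ O x x := by
    have := h.supporting x y (coe_ne_coe_of_mem_Ioo ⟨hxy, hy⟩).symm
    have h2 := height_sub_height γ O x y x
    linarith
  have hper : height γ O x ((x + 2 * Real.pi : ℝ) : Circ) = height γ O x x := by
    rw [AddCircle.coe_add_period]
  constructor
  · obtain ⟨w, hw, hwe⟩ := exists_hasDerivAt_eq_slope _ _ hxy hcH.continuousOn fun z _ => hH z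
    have hwpos : 0 < tangentDet γ x w := by
      have : -tangentDet γ x w < 0 := hwe ▸ div_neg_of_neg_of_pos (by linarith) (by linarith)
      linarith
    intro z hz
    by_contra hneg
    obtain ⟨q, hq, hq0⟩ := (isPreconnected_Ioo.image _ hcD.continuousOn).ordConnected.out
      (mem_image_of_mem _ hz) (mem_image_of_mem _ hw) ⟨not_lt.1 hneg, hwpos.le⟩
    exact hne q ⟨hq.1, hq.2.trans hy⟩ hq.2.ne hq0
  · obtain ⟨w, hw, hwe⟩ := exists_hasDerivAt_eq_slope _ _ hy hcH.continuousOn fun z _ => hH z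
    have hwneg : tangentDet γ x w < 0 := by
      have : 0 < -tangentDet γ x w := by
        rw [hwe, hper]; exact div_pos (by linarith) (by linarith)
      linarith
    intro z hz
    by_contra hneg
    obtain ⟨q, hq, hq0⟩ := (isPreconnected_Ioo.image _ hcD.continuousOn).ordConnected.out
      (mem_image_of_mem _ hw) (mem_image_of_mem _ hz) ⟨hwneg.le, not_lt.1 hneg⟩
    exact hne q ⟨hxy.trans hq.1, hq.2⟩ hq.1.ne' hq0

theorem exists_lift_opposite (h : IsSymmetricOval γ O) (x : ℝ) :
    ∃ y, x < y ∧ y < x + 2 * Real.pi ∧ (y : Circ) = opposite γ x := by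
  obtain ⟨y, hy, hyo⟩ := exists_lift x (opposite γ x)
  refine ⟨y, lt_of_le_of_ne hy.1 ?_, hy.2, hyo⟩
  rintro rfl
  exact h.opposite_ne _ hyo.symm

theorem positiveAdmissible_iff (h : IsSymmetricOval γ O) {t u : Circ} :
    PositiveAdmissible γ t u ↔ 0 < tangentDet γ t u := by
  constructor
  · rintro ⟨x, y, z, rfl, hy, rfl, hxy, hyx, hxz, hzy⟩
    exact (h.sign_of_lift hxy hyx hy).1 z ⟨hxz, hzy⟩
  · intro hd
    obtain ⟨x, rfl⟩ := QuotientAddGroup.mk_surjective t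
    obtain ⟨y, hxy, hyx, hy⟩ := h.exists_lift_opposite x
    obtain ⟨z, hz, rfl⟩ := exists_lift x u
    refine ⟨x, y, z, rfl, hy, rfl, hxy, hyx, lt_of_le_of_ne hz.1 ?_, ?_⟩
    · rintro rfl
      exact hd.ne' (det2_self _)
    · refine lt_of_le_of_ne (not_lt.1 fun hyz => ?_) ?_
      · exact lt_asymm hd ((h.sign_of_lift hxy hyx hy).2 z ⟨hyz, hz.2⟩)
      · rintro rfl
        exact hd.ne' (h.tangentDet_eq_zero_iff.2 (Or.inr hy))

theorem exists_lift_of_tangentDet_nonneg (h : IsSymmetricOval γ O) {x y : ℝ} (hxy : x < y)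
    (hyx : y < x + 2 * Real.pi) (hy : (y : Circ) = opposite γ x) {u : Circ}
    (hd : 0 ≤ tangentDet γ x u) : ∃ z ∈ Icc x y, (z : Circ) = u := by
  obtain ⟨z, hz, rfl⟩ := exists_lift x u
  refine ⟨z, ⟨hz.1, not_lt.1 fun hyz => ?_⟩, rfl⟩
  exact not_lt.2 hd ((h.sign_of_lift hxy hyx hy).2 z ⟨hyz, hz.2⟩)

theorem strictAntiOn_height (h : IsSymmetricOval γ O) {x y : ℝ} (hxy : x < y)
    (hyx : y < x + 2 * Real.pi) (hy : (y : Circ) = opposite γ x) :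
    StrictAntiOn (fun z : ℝ => height γ O x z) (Icc x y) := by
  refine strictAntiOn_of_deriv_neg (convex_Icc x y)
    (fun z _ => (h.hasDerivAt_height x z).continuousAt.continuousWithinAt) fun z hz => ?_
  rw [interior_Icc] at hz
  rw [(h.hasDerivAt_height x z).deriv]
  exact neg_neg_of_pos ((h.sign_of_lift hxy hyx hy).1 z hz)

theorem height_injOn (h : IsSymmetricOval γ O) (t : Circ) :
    InjOn (height γ O t) {u | 0 ≤ tangentDet γ t u} := by
  obtain ⟨x, rfl⟩ := QuotientAddGroup.mk_surjective t
  obtain ⟨y, hxy, hyx, hy⟩ := h.exists_lift_opposite x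
  intro u hu w hw huw
  obtain ⟨z, hz, rfl⟩ := h.exists_lift_of_tangentDet_nonneg hxy hyx hy hu
  obtain ⟨z', hz', rfl⟩ := h.exists_lift_of_tangentDet_nonneg hxy hyx hy hw
  rw [(h.strictAntiOn_height hxy hyx hy).injOn hz hz' huw]

theorem exists_height_eq (h : IsSymmetricOval γ O) {t : Circ} {s : ℝ}
    (hs : |s| < height γ O t t) : ∃ u, 0 < tangentDet γ t u ∧ height γ O t u = s := by
  obtain ⟨x, rfl⟩ := QuotientAddGroup.mk_surjective t
  obtain ⟨y, hxy, hyx, hy⟩ := h.exists_lift_opposite x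
  have hend : height γ O (x : Circ) y = -height γ O (x : Circ) x := by
    rw [hy, h.height_opposite_right]
  have hmem : s ∈ Ioo (height γ O (x : Circ) y) (height γ O (x : Circ) x) := by
    rw [hend]; exact abs_lt.1 hs
  obtain ⟨z, hz, hzs⟩ := intermediate_value_Ioo' hxy.le
    (fun z _ => (h.hasDerivAt_height x z).continuousAt.continuousWithinAt) hmem
  exact ⟨z, (h.sign_of_lift hxy hyx hy).1 z hz, hzs⟩

theorem abs_height_lt (h : IsSymmetricOval γ O) {t u : Circ} (hd : 0 < tangentDet γ t u) :
    |height γ O t u| < height γ O t t := by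
  have h1 : u ≠ t := by rintro rfl; exact hd.ne' (det2_self _)
  have h2 : u ≠ opposite γ t := by
    rintro rfl; exact hd.ne' (h.tangentDet_eq_zero_iff.2 (Or.inr rfl))
  have h3 : opposite γ u ≠ t := by
    rintro rfl; exact h2 (h.opposite_opposite u).symm
  have h4 := h.supporting t u h1.symm
  have h5 := h.supporting t _ h3.symm
  have h6 := height_sub_height γ O t u t
  have h7 := height_sub_height γ O t (opposite γ u) t
  rw [h.height_opposite_right] at h7
  exact abs_lt.2 ⟨by linarith, by linarith⟩

end IsSymmetricOval

/-! ### The billiard map of a centrally symmetric oval -/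

/-- A map defined through a continuous change of coordinates on a compact set is continuous. -/
theorem continuousOn_of_comp_eqOn {X Y Z : Type*} [TopologicalSpace X] [T2Space X]
    [TopologicalSpace Y] [T2Space Y] [TopologicalSpace Z] {K : Set X} (hK : IsCompact K)
    {φ : X → Y} {χ : X → Z}
    (hφ : ContinuousOn φ K) (hχ : ContinuousOn χ K) {P : Set Y} (hP : P ⊆ φ '' K) {T : Y → Z}
    (hT : ∀ q ∈ K, φ q ∈ P → T (φ q) = χ q) : ContinuousOn T P := by
  refine continuousOn_iff_isClosed.2 fun C hC => ?_
  refine ⟨φ '' (K ∩ χ ⁻¹' C), ?_, ?_⟩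
  · have hKC : IsCompact (K ∩ χ ⁻¹' C) :=
      hK.of_isClosed_subset (hχ.preimage_isClosed_of_isClosed hK.isClosed hC) inter_subset_left
    exact (hKC.image_of_continuousOn (hφ.mono inter_subset_left)).isClosed
  · ext y
    refine and_congr_left fun hy => ?_
    constructor
    · intro hyC
      obtain ⟨q, hq, rfl⟩ := hP hy
      exact ⟨q, ⟨hq, by rwa [mem_preimage, ← hT q hq hy]⟩, rfl⟩
    · rintro ⟨q, ⟨hq, hqC⟩, rfl⟩
      rwa [mem_preimage, hT q hq hy]

theorem volume_image_fiberContraction {lam : ℝ} (hlam : 0 < lam) {C : Set (Circ × ℝ)}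
    (hC : IsCompact C) :
    volume (fiberContraction lam '' C) = ENNReal.ofReal lam * volume C := by
  have hcont : Continuous (fiberContraction lam) := by unfold fiberContraction; fun_prop
  rw [Measure.volume_eq_prod, Measure.prod_apply (hC.image hcont).measurableSet,
    Measure.prod_apply hC.measurableSet, ← lintegral_const_mul' _ _ ENNReal.ofReal_ne_top]
  refine lintegral_congr fun t => ?_
  have : Prod.mk t ⁻¹' (fiberContraction lam '' C) = lam • (Prod.mk t ⁻¹' C) := by
    ext s
    constructor
    · rintro ⟨⟨u, r⟩, hr, he⟩
      obtain ⟨rfl, rfl⟩ := Prod.mk.inj he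
      exact ⟨r, hr, rfl⟩
    · rintro ⟨r, hr, rfl⟩
      exact ⟨(t, r), hr, rfl⟩
  rw [this, Measure.addHaar_smul]
  simp [abs_of_pos hlam]

namespace IsSymmetricOval

variable {γ : Circ → Plane} {O : Plane}

theorem phaseSpaceHat_eq (h : IsSymmetricOval γ O) :
    phaseSpaceHat γ = {p | 0 < tangentDet γ p.1 p.2} := by
  ext p; exact h.positiveAdmissible_iff

theorem lowerBoundary_eq (h : IsSymmetricOval γ O) : lowerBoundary γ O = -upperBoundary γ O := by
  ext t; exact h.height_opposite_right t t

theorem continuous_upperBoundary (h : IsSymmetricOval γ O) : Continuous (upperBoundary γ O) :=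
  h.continuous_height.comp (continuous_id.prodMk continuous_id)

theorem continuous_coord (h : IsSymmetricOval γ O) : Continuous (coord γ O) :=
  continuous_fst.prodMk h.continuous_height

theorem tangentDet_pos_of_abs_height_lt (h : IsSymmetricOval γ O) {t u : Circ}
    (hd : 0 ≤ tangentDet γ t u) (hh : |height γ O t u| < height γ O t t) :
    0 < tangentDet γ t u := by
  refine lt_of_le_of_ne hd fun h0 => ?_
  rcases h.tangentDet_eq_zero_iff.1 h0.symm with rfl | rfl
  · exact absurd (le_abs_self _) (not_le.2 hh)
  · rw [h.height_opposite_right, abs_neg] at hh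
    exact absurd (le_abs_self _) (not_le.2 hh)

theorem coord_mem_annulus (h : IsSymmetricOval γ O) {p : Circ × Circ}
    (hp : 0 < tangentDet γ p.1 p.2) :
    coord γ O p ∈ annulus (-upperBoundary γ O) (upperBoundary γ O) :=
  mem_annulus_neg.2 (h.abs_height_lt hp)

theorem exists_coord_eq (h : IsSymmetricOval γ O) {q : Circ × ℝ}
    (hq : q ∈ annulus (-upperBoundary γ O) (upperBoundary γ O)) :
    ∃ p : Circ × Circ, 0 < tangentDet γ p.1 p.2 ∧ coord γ O p = q := by
  obtain ⟨u, hu, hus⟩ := h.exists_height_eq (mem_annulus_neg.1 hq)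
  exact ⟨(q.1, u), hu, Prod.ext rfl hus⟩

theorem coord_injOn (h : IsSymmetricOval γ O) :
    InjOn (coord γ O) {p | 0 ≤ tangentDet γ p.1 p.2} := by
  rintro ⟨t, u⟩ hu ⟨t', u'⟩ hu' he
  obtain ⟨rfl, he2⟩ := Prod.mk.inj he
  exact Prod.ext rfl (h.height_injOn t hu hu' he2)

theorem abs_height_swap_lt (h : IsSymmetricOval γ O) {t u : Circ} (hd : 0 < tangentDet γ t u) :
    |height γ O u t| < height γ O u u := by
  rw [← abs_neg, ← h.height_opposite_right]
  exact h.abs_height_lt ((h.tangentDet_opposite_right_pos_iff u t).2 hd)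

theorem height_injOn_left (h : IsSymmetricOval γ O) (u : Circ) :
    InjOn (height γ O u) {t | 0 < tangentDet γ t u} := by
  intro t ht t' ht' he
  have h1 : height γ O u (opposite γ t) = height γ O u (opposite γ t') := by
    rw [h.height_opposite_right, h.height_opposite_right, he]
  have h2 := h.height_injOn u ((h.tangentDet_opposite_right_pos_iff u t).2 ht).le
    ((h.tangentDet_opposite_right_pos_iff u t').2 ht').le h1
  rw [← h.opposite_opposite t, h2, h.opposite_opposite]

/-- The billiard map in closed form: the chord from `γ(t)` to the next point is parallel to
`γ'(u)`, so both endpoints have the same height with respect to `u`. -/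
theorem billiardMap_coord (h : IsSymmetricOval γ O) {p : Circ × Circ}
    (hp : 0 < tangentDet γ p.1 p.2) :
    billiardMap γ O (coord γ O p) = (p.2, height γ O p.2 p.1) := by
  have hinj : InjOn (coord γ O) (phaseSpaceHat γ) := by
    rw [h.phaseSpaceHat_eq]
    refine h.coord_injOn.mono ?_
    exact fun q (hq : 0 < tangentDet γ q.1 q.2) => hq.le
  have hmem : p ∈ phaseSpaceHat γ := by rw [h.phaseSpaceHat_eq]; exact hp
  simp only [billiardMap, Function.comp_apply, hinj.leftInvOn_invFunOn hmem]
  obtain ⟨w, hw, hwe⟩ := h.exists_height_eq (h.abs_height_swap_lt hp)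
  have hwp : w ≠ p.1 := by
    rintro rfl
    rw [tangentDet_comm] at hw
    linarith
  have hspec := Classical.epsilon_spec
    (p := fun t₃ => t₃ ≠ p.1 ∧ det2 (velocity γ p.2) (γ t₃ - γ p.1) = 0)
    ⟨w, hwp, by rw [← neg_eq_zero, ← height_sub_height γ O, hwe, sub_self]⟩
  refine Prod.ext rfl (sub_eq_zero.1 ?_)
  exact (height_sub_height γ O p.2 _ p.1).trans (neg_eq_zero.2 hspec.2)

theorem continuousOn_billiardMap (h : IsSymmetricOval γ O) :
    ContinuousOn (billiardMap γ O) (annulus (-upperBoundary γ O) (upperBoundary γ O)) := by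
  have hK : IsCompact {p : Circ × Circ | 0 ≤ tangentDet γ p.1 p.2} :=
    (isClosed_le continuous_const h.continuous_tangentDet).isCompact
  have hχ : Continuous fun p : Circ × Circ => (p.2, height γ O p.2 p.1) :=
    continuous_snd.prodMk (h.continuous_height.comp continuous_swap)
  refine continuousOn_of_comp_eqOn hK h.continuous_coord.continuousOn hχ.continuousOn ?_ ?_
  · intro q hq
    obtain ⟨p, hp, rfl⟩ := h.exists_coord_eq hq
    exact ⟨p, le_of_lt hp, rfl⟩
  · intro p hp hpa
    exact h.billiardMap_coord (h.tangentDet_pos_of_abs_height_lt hp (mem_annulus_neg.1 hpa))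

theorem injOn_billiardMap (h : IsSymmetricOval γ O) :
    InjOn (billiardMap γ O) (annulus (-upperBoundary γ O) (upperBoundary γ O)) := by
  intro q hq q' hq' he
  obtain ⟨⟨t, u⟩, hp, rfl⟩ := h.exists_coord_eq hq
  obtain ⟨⟨t', u'⟩, hp', rfl⟩ := h.exists_coord_eq hq'
  rw [h.billiardMap_coord hp, h.billiardMap_coord hp'] at he
  obtain ⟨rfl, he2⟩ := Prod.mk.inj he
  exact congrArg (coord γ O) (Prod.ext (h.height_injOn_left u hp hp' he2) rfl)

theorem image_billiardMap (h : IsSymmetricOval γ O) :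
    billiardMap γ O '' annulus (-upperBoundary γ O) (upperBoundary γ O) =
      annulus (-upperBoundary γ O) (upperBoundary γ O) := by
  refine Subset.antisymm ?_ ?_
  · rintro _ ⟨q, hq, rfl⟩
    obtain ⟨p, hp, rfl⟩ := h.exists_coord_eq hq
    rw [h.billiardMap_coord hp]
    exact mem_annulus_neg.2 (h.abs_height_swap_lt hp)
  · rintro ⟨u, s⟩ hq
    have hs : |-s| < height γ O u u := by rw [abs_neg]; exact mem_annulus_neg.1 hq
    obtain ⟨w, hw, hws⟩ := h.exists_height_eq hs
    have hd : 0 < tangentDet γ (opposite γ w) u := by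
      rwa [← h.tangentDet_opposite_right_pos_iff, h.opposite_opposite]
    refine ⟨_, h.coord_mem_annulus (p := (opposite γ w, u)) hd, ?_⟩
    rw [h.billiardMap_coord hd]
    dsimp only
    rw [h.height_opposite_right, hws, neg_neg]

/-- The length of the image of a fibre, by the change of variables formula on the line. -/
theorem volume_image_height (h : IsSymmetricOval γ O) (t : Circ) {F : Set Circ}
    (hF : MeasurableSet F) (hinj : InjOn (height γ O t) F) :
    volume (height γ O t '' F) = ∫⁻ u in F, ENNReal.ofReal |tangentDet γ t u| := by
  set G : Set ℝ := Ioc 0 (0 + 2 * Real.pi) ∩ (fun x : ℝ => (x : Circ)) ⁻¹' F with hG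
  have hpre : MeasurableSet ((fun x : ℝ => (x : Circ)) ⁻¹' F) :=
    (AddCircle.continuous_mk' (2 * Real.pi)).measurable hF
  have hGm : MeasurableSet G := measurableSet_Ioc.inter hpre
  have himg : height γ O t '' F = (fun x : ℝ => height γ O t x) '' G := by
    refine Subset.antisymm ?_ ?_
    · rintro _ ⟨u, hu, rfl⟩
      have : u ∈ ((↑) : ℝ → Circ) '' Ioc 0 (0 + 2 * Real.pi) := by
        rw [AddCircle.coe_image_Ioc_eq]; trivial
      obtain ⟨x, hx, rfl⟩ := this
      exact ⟨x, ⟨hx, hu⟩, rfl⟩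
    · rintro _ ⟨x, hx, rfl⟩
      exact ⟨x, hx.2, rfl⟩
  have hGinj : InjOn (fun x : ℝ => height γ O t x) G := fun x hx y hy hxy =>
    (AddCircle.coe_eq_coe_iff_of_mem_Ioc (p := 2 * Real.pi) hx.1 hy.1).1 (hinj hx.2 hy.2 hxy)
  have hcv := lintegral_image_eq_lintegral_abs_deriv_mul hGm
    (fun x _ => (h.hasDerivAt_height t x).hasDerivWithinAt) hGinj (fun _ => 1)
  simp only [lintegral_const, one_mul, Measure.restrict_apply, MeasurableSet.univ, univ_inter,
    mul_one, abs_neg] at hcv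
  rw [himg, hcv, ← lintegral_indicator hF,
    ← AddCircle.lintegral_preimage (2 * Real.pi) 0, hG, inter_comm, ← setLIntegral_indicator hpre]
  rfl

/-- Area preservation: in the coordinates `(t, u)`, both `(t, s)` and its image under the billiard
map have the area density `|det(γ'(t), γ'(u))|`, which is symmetric in `t` and `u`. -/
theorem volume_image_billiardMap (h : IsSymmetricOval γ O) {C : Set (Circ × ℝ)}
    (hCA : C ⊆ annulus (-upperBoundary γ O) (upperBoundary γ O)) (hC : IsCompact C) :
    volume (billiardMap γ O '' C) = volume C := by
  set E : Set (Circ × Circ) := {p | 0 ≤ tangentDet γ p.1 p.2} ∩ coord γ O ⁻¹' C with hE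
  have hEc : IsClosed E := (isClosed_le continuous_const h.continuous_tangentDet).inter
    (hC.isClosed.preimage h.continuous_coord)
  have hEpos : ∀ p ∈ E, 0 < tangentDet γ p.1 p.2 := fun p hp =>
    h.tangentDet_pos_of_abs_height_lt hp.1 (mem_annulus_neg.1 (hCA hp.2))
  have hTC : IsCompact (billiardMap γ O '' C) :=
    hC.image_of_continuousOn (h.continuousOn_billiardMap.mono hCA)
  have hslice : ∀ t, Prod.mk t ⁻¹' C = height γ O t '' (Prod.mk t ⁻¹' E) := by
    intro t
    ext s
    constructor
    · intro hs
      obtain ⟨⟨t', u⟩, hd, he⟩ := h.exists_coord_eq (hCA hs)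
      obtain ⟨rfl, rfl⟩ := Prod.mk.inj he
      exact ⟨u, ⟨le_of_lt hd, hs⟩, rfl⟩
    · rintro ⟨u, hu, rfl⟩
      exact hu.2
  have hslice' : ∀ u, Prod.mk u ⁻¹' (billiardMap γ O '' C) =
      height γ O u '' ((fun t => (t, u)) ⁻¹' E) := by
    intro u
    ext s
    constructor
    · rintro ⟨q, hq, hqe⟩
      obtain ⟨⟨t, u'⟩, hd, rfl⟩ := h.exists_coord_eq (hCA hq)
      rw [h.billiardMap_coord hd] at hqe
      obtain ⟨rfl, rfl⟩ := Prod.mk.inj hqe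
      exact ⟨t, ⟨le_of_lt hd, hq⟩, rfl⟩
    · rintro ⟨t, ht, rfl⟩
      exact ⟨coord γ O (t, u), ht.2, h.billiardMap_coord (hEpos _ ht)⟩
  set W : Circ × Circ → ENNReal := E.indicator fun p => ENNReal.ofReal |tangentDet γ p.1 p.2|
    with hW
  have hWm : Measurable W :=
    (h.continuous_tangentDet.abs.measurable.ennreal_ofReal).indicator hEc.measurableSet
  have h1 : volume C = ∫⁻ t, ∫⁻ u, W (t, u) := by
    rw [Measure.volume_eq_prod, Measure.prod_apply hC.measurableSet]
    refine lintegral_congr fun t => ?_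
    have hm : MeasurableSet (Prod.mk t ⁻¹' E) := measurable_prodMk_left hEc.measurableSet
    rw [hslice, h.volume_image_height t hm
      ((h.height_injOn t).mono fun u hu => hu.1), ← lintegral_indicator hm]
    rfl
  have h2 : volume (billiardMap γ O '' C) = ∫⁻ u, ∫⁻ t, W (t, u) := by
    rw [Measure.volume_eq_prod, Measure.prod_apply hTC.measurableSet]
    refine lintegral_congr fun u => ?_
    have hm : MeasurableSet ((fun t => (t, u)) ⁻¹' E) :=
      measurable_prodMk_right hEc.measurableSet
    rw [hslice', h.volume_image_height u hm
      ((h.height_injOn_left u).mono fun t ht => hEpos _ ht), ← lintegral_indicator hm]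
    refine lintegral_congr fun t => ?_
    have hsymm : |tangentDet γ u t| = |tangentDet γ t u| := by rw [tangentDet_comm, abs_neg]
    by_cases ht : (t, u) ∈ E
    · rw [indicator_of_mem (s := (fun t => (t, u)) ⁻¹' E) ht, hW, indicator_of_mem ht, hsymm]
    · rw [indicator_of_notMem (s := (fun t => (t, u)) ⁻¹' E) ht, hW, indicator_of_notMem ht]
  rw [h1, h2]
  exact lintegral_lintegral_swap (f := fun u t => W (t, u))
    (hWm.comp measurable_swap).aemeasurable

theorem dissipativeBilliardMap_coord (h : IsSymmetricOval γ O) (lam : ℝ) {p : Circ × Circ}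
    (hp : 0 < tangentDet γ p.1 p.2) :
    dissipativeBilliardMap γ O lam (coord γ O p) = (p.2, lam * height γ O p.2 p.1) := by
  rw [dissipativeBilliardMap, Function.comp_apply, h.billiardMap_coord hp]; rfl

/-- Pairs `(t, u)` close to the diagonal, or to the pairs `(t, t^*)`, show that the billiard map
extends to the boundary components of the annulus, as `t ↦ t` and `t ↦ t^*` respectively. -/
theorem exists_mem_closure_image_collar (h : IsSymmetricOval γ O) {lam : ℝ}
    (hlam : lam ∈ Ioo (0 : ℝ) 1) {ε : ℝ} (hε : ε = 1 ∨ ε = -1) :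
    ∃ t, (t, ε * (lam * upperBoundary γ O t)) ∈
      closure (dissipativeBilliardMap γ O lam '' collar (upperBoundary γ O) lam ε) := by
  obtain ⟨y, hxy, hyx, hy⟩ := h.exists_lift_opposite 0
  have hpos := (h.sign_of_lift hxy hyx hy).1
  have hH1 : Continuous fun z : ℝ => height γ O (0 : ℝ) z :=
    h.continuous_height.comp (continuous_const.prodMk (AddCircle.continuous_mk' _))
  have hH2 : Continuous fun z : ℝ => ((z, lam * height γ O z (0 : ℝ)) : Circ × ℝ) :=
    (AddCircle.continuous_mk' _).prodMk (continuous_const.mul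
      (h.continuous_height.comp ((AddCircle.continuous_mk' _).prodMk continuous_const)))
  have hψ := h.height_self_pos (0 : ℝ)
  have hlt : lam * height γ O (0 : ℝ) (0 : ℝ) < height γ O (0 : ℝ) (0 : ℝ) := by
    nlinarith [hlam.2]
  -- it suffices to approximate the boundary within a fibre of the collar
  have key : ∀ w : ℝ, ∀ l : Filter ℝ, l.NeBot → l ≤ 𝓝 w → (∀ᶠ z in l, z ∈ Ioo 0 y) →
      ε * height γ O (0 : ℝ) w = height γ O (0 : ℝ) (0 : ℝ) →
      ((w, lam * height γ O w (0 : ℝ)) : Circ × ℝ) ∈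
        closure (dissipativeBilliardMap γ O lam '' collar (upperBoundary γ O) lam ε) := by
    intro w l _ hl hzl hw
    refine mem_closure_of_tendsto ((hH2.tendsto w).mono_left hl) ?_
    have h1 : ∀ᶠ z : ℝ in l, lam * height γ O (0 : ℝ) (0 : ℝ) < ε * height γ O (0 : ℝ) z := by
      have hc : Continuous fun z : ℝ => ε * height γ O (0 : ℝ) z := continuous_const.mul hH1
      exact ((hc.tendsto w).mono_left hl).eventually_const_lt (by rwa [hw])
    filter_upwards [h1, hzl] with z hz1 hz
    have hd := hpos z hz
    refine ⟨coord γ O ((0 : ℝ), z), ⟨hz1.le, ?_⟩, h.dissipativeBilliardMap_coord lam hd⟩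
    have := h.abs_height_lt hd
    rw [← abs_sign_mul hε] at this
    exact (le_abs_self _).trans_lt this
  rcases hε with rfl | rfl
  · refine ⟨(0 : ℝ), ?_⟩
    have := key 0 (𝓝[>] 0) inferInstance nhdsWithin_le_nhds (Ioo_mem_nhdsGT hxy) (one_mul _)
    rwa [one_mul]
  · refine ⟨y, ?_⟩
    have := key y (𝓝[<] y) inferInstance nhdsWithin_le_nhds (Ioo_mem_nhdsLT hxy)
      (by rw [hy, h.height_opposite_right]; ring)
    convert this using 2
    have h0 : ((0 : ℝ) : Circ) = opposite γ y := by rw [hy, h.opposite_opposite]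
    rw [h0, h.height_opposite_right]
    change -1 * (lam * height γ O y y) = _
    ring

/-- If conjugacy of directions is symmetric, the dissipative billiard map satisfies all the
requirements on a dissipative embedding of the annulus. -/
theorem isDissipativeEmbedding (h : IsSymmetricOval γ O)
    (hconj : ∀ t u, height γ O t u = 0 → height γ O u t = 0) {lam : ℝ}
    (hlam : lam ∈ Ioo (0 : ℝ) 1) :
    IsDissipativeEmbedding (upperBoundary γ O) lam (dissipativeBilliardMap γ O lam) where
  continuous_radius := h.continuous_upperBoundary
  radius_pos := h.height_self_pos
  lam_mem := hlam
  continuousOn := by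
    have : Continuous (fiberContraction lam) := by unfold fiberContraction; fun_prop
    exact this.comp_continuousOn h.continuousOn_billiardMap
  injOn := by
    refine InjOn.comp (t := univ) (fun p _ q _ hpq => ?_) h.injOn_billiardMap (mapsTo_univ _ _)
    obtain ⟨h1, h2⟩ := Prod.mk.inj hpq
    exact Prod.ext h1 (mul_left_cancel₀ hlam.1.ne' h2)
  image_eq := by
    rw [dissipativeBilliardMap, image_comp, h.image_billiardMap]
    ext ⟨t, s⟩
    constructor
    · rintro ⟨⟨u, r⟩, hr, he⟩
      obtain ⟨rfl, rfl⟩ := Prod.mk.inj he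
      change |lam * r| < lam * _
      rw [abs_mul, abs_of_pos hlam.1]
      exact mul_lt_mul_of_pos_left (mem_annulus_neg.1 hr) hlam.1
    · intro hs
      have hs' : |s| < lam * upperBoundary γ O t := hs
      refine ⟨(t, s / lam), mem_annulus_neg.2 ?_, Prod.ext rfl (mul_div_cancel₀ _ hlam.1.ne')⟩
      rw [abs_div, abs_of_pos hlam.1]
      exact (div_lt_iff₀' hlam.1).2 hs'
  snd_eq_zero_iff := by
    intro q hq
    obtain ⟨p, hp, rfl⟩ := h.exists_coord_eq hq
    rw [h.dissipativeBilliardMap_coord lam hp]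
    change lam * height γ O p.2 p.1 = 0 ↔ height γ O p.1 p.2 = 0
    rw [mul_eq_zero, or_iff_right hlam.1.ne']
    exact ⟨hconj _ _, hconj _ _⟩
  boundary := fun _ hε => h.exists_mem_closure_image_collar hlam hε
  volume_image := by
    intro C hCA hC
    rw [dissipativeBilliardMap, image_comp, volume_image_fiberContraction hlam.1
      (hC.image_of_continuousOn (h.continuousOn_billiardMap.mono hCA)),
      h.volume_image_billiardMap hCA hC]

end IsSymmetricOval

/-! ### Boundaries of centrally symmetric strictly convex domains -/

theorem IsStrictlyConvexDomain.interior_closure {Ω : Set Plane} (hΩ : IsStrictlyConvexDomain Ω) :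
    interior (closure Ω) = Ω := by
  rw [hΩ.convex.interior_closure_eq_interior_of_nonempty_interior
    (by rw [hΩ.isOpen.interior_eq]; exact hΩ.nonempty), hΩ.isOpen.interior_eq]

theorem IsStrictlyConvexDomain.midpoint_mem {Ω : Set Plane} (hΩ : IsStrictlyConvexDomain Ω)
    {x y : Plane} (hx : x ∈ closure Ω) (hy : y ∈ closure Ω) (hxy : x ≠ y) :
    (1 / 2 : ℝ) • x + (1 / 2 : ℝ) • y ∈ Ω := by
  have := hΩ.strictConvex hx hy hxy (a := 1 / 2) (b := 1 / 2) (by norm_num) (by norm_num)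
    (by norm_num)
  rwa [hΩ.interior_closure] at this

theorem IsCentrallySymmetric.preimage_eq {Ω : Set Plane} {O : Plane}
    (hO : IsCentrallySymmetric Ω O) : Homeomorph.subLeft ((2 : ℝ) • O) ⁻¹' Ω = Ω :=
  Set.ext fun x => (hO x).symm

theorem IsCentrallySymmetric.mem_frontier {Ω : Set Plane} {O : Plane}
    (hO : IsCentrallySymmetric Ω O) {x : Plane} (hx : x ∈ frontier Ω) :
    (2 : ℝ) • O - x ∈ frontier Ω := by
  rw [← hO.preimage_eq, ← Homeomorph.preimage_frontier] at hx
  exact hx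

theorem IsCentrallySymmetric.mem_closure {Ω : Set Plane} {O : Plane}
    (hO : IsCentrallySymmetric Ω O) {x : Plane} (hx : x ∈ closure Ω) :
    (2 : ℝ) • O - x ∈ closure Ω := by
  rw [← hO.preimage_eq, ← Homeomorph.preimage_closure] at hx
  exact hx

theorem IsCentrallySymmetric.center_mem {Ω : Set Plane} {O : Plane}
    (hO : IsCentrallySymmetric Ω O) (hΩ : IsStrictlyConvexDomain Ω) : O ∈ Ω := by
  obtain ⟨x, hx⟩ := hΩ.nonempty
  have := hΩ.convex hx ((hO x).1 hx) (a := 1 / 2) (b := 1 / 2) (by norm_num) (by norm_num)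
    (by norm_num)
  convert this using 1
  module

theorem isQuotientMap_coe : IsQuotientMap ((↑) : ℝ → Circ) :=
  QuotientAddGroup.isOpenQuotientMap_mk.isQuotientMap

theorem velocity_coe (γ : Circ → Plane) (x : ℝ) :
    velocity γ x = deriv (fun y : ℝ => γ y) x := by
  have := deriv_comp_const_add (f := fun y : ℝ => γ y) x 0
  rw [add_zero] at this
  rw [← this]
  rfl

theorem IsBoundaryParametrization.isSymmetricOval {Ω : Set Plane} {γ : Circ → Plane} {O : Plane}
    (hγ : IsBoundaryParametrization Ω γ) (hΩ : IsStrictlyConvexDomain Ω)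
    (hO : IsCentrallySymmetric Ω O) : IsSymmetricOval γ O where
  hasDerivAt x := by
    rw [velocity_coe]
    exact (hγ.contDiff.differentiable (by norm_num) x).hasDerivAt
  continuous := isQuotientMap_coe.continuous_iff.2 hγ.contDiff.continuous
  continuous_velocity := by
    refine isQuotientMap_coe.continuous_iff.2 ?_
    have : velocity γ ∘ ((↑) : ℝ → Circ) = deriv fun y : ℝ => γ y := funext (velocity_coe γ)
    rw [this]
    exact hγ.contDiff.continuous_deriv (by norm_num)
  height_self_pos t := by
    have := hγ.counterclockwise t O (hO.center_mem hΩ)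
    rw [← neg_sub, det2_neg_right] at this
    exact this
  supporting t u htu := by
    have hmem : ∀ w, γ w ∈ closure Ω := fun w =>
      frontier_subset_closure (hγ.range_eq ▸ mem_range_self w)
    have h1 := hγ.counterclockwise t _
      (hΩ.midpoint_mem (hmem t) (hmem u) fun he => htu (hγ.injective he))
    have h2 : (1 / 2 : ℝ) • γ t + (1 / 2 : ℝ) • γ u - γ t = (1 / 2 : ℝ) • (γ u - γ t) := by module
    rw [h2, det2_smul_right] at h1
    linarith
  exists_antipode t := by
    have h1 : γ t ∈ frontier Ω := hγ.range_eq ▸ mem_range_self t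
    have h2 := hO.mem_frontier h1
    rw [← hγ.range_eq] at h2
    obtain ⟨u, hu⟩ := h2
    exact ⟨u, by rw [hu]; module⟩

/-- A nonzero linear functional attains its maximum over the closure of the domain at a boundary
point, and is strictly smaller on the domain. -/
theorem IsBoundaryParametrization.exists_det2_max {Ω : Set Plane} {γ : Circ → Plane}
    (hγ : IsBoundaryParametrization Ω γ) (hΩ : IsStrictlyConvexDomain Ω) {n : Plane}
    (hn : n ≠ 0) :
    ∃ t, (∀ x ∈ closure Ω, det2 n x ≤ det2 n (γ t)) ∧ ∀ x ∈ Ω, det2 n x < det2 n (γ t) := by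
  have hcont : Continuous (det2 n) := continuous_det2.comp (continuous_const.prodMk continuous_id)
  obtain ⟨x₀, hx₀, hmax⟩ := hΩ.isBounded.isCompact_closure.exists_isMaxOn hΩ.nonempty.closure
    hcont.continuousOn
  have hstrict : ∀ x ∈ Ω, det2 n x < det2 n x₀ := by
    intro x hx
    set w : Plane := !₂[-n 1, n 0] with hw
    have hdw : 0 < det2 n w := by
      have : det2 n w = n 0 ^ 2 + n 1 ^ 2 := by simp [det2, hw]; ring
      rw [this]
      by_contra hneg
      have h0 : n 0 = 0 := by nlinarith [sq_nonneg (n 0), sq_nonneg (n 1)]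
      have h1 : n 1 = 0 := by nlinarith [sq_nonneg (n 0), sq_nonneg (n 1)]
      exact hn (by ext i; fin_cases i <;> simp [h0, h1])
    have hline : Tendsto (fun ε : ℝ => x + ε • w) (𝓝[>] 0) (𝓝 x) := by
      have : Continuous fun ε : ℝ => x + ε • w := by fun_prop
      simpa using (this.tendsto 0).mono_left nhdsWithin_le_nhds
    obtain ⟨ε, hεΩ, hε⟩ := ((hline.eventually (hΩ.isOpen.mem_nhds hx)).and
      self_mem_nhdsWithin).exists
    have h1 : det2 n (x + ε • w) ≤ det2 n x₀ := hmax (subset_closure hεΩ)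
    rw [det2_add_right, det2_smul_right] at h1
    nlinarith [mul_pos (show (0 : ℝ) < ε from hε) hdw]
  have hfr : x₀ ∈ frontier Ω := by
    rw [hΩ.isOpen.frontier_eq]
    exact ⟨hx₀, fun hm => lt_irrefl _ (hstrict _ hm)⟩
  rw [← hγ.range_eq] at hfr
  obtain ⟨t, rfl⟩ := hfr
  exact ⟨t, fun x hx => hmax hx, hstrict⟩

/-! ### Conjugate directions of Radon domains -/

/-- If `|det(a, b)|` is at least as large as all the values taken by pairs of boundary points, then
`a` points to the boundary. -/
theorem IsBoundaryParametrization.notMem_of_det2_max {Ω : Set Plane} {γ : Circ → Plane}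
    {O : Plane} (hγ : IsBoundaryParametrization Ω γ) (hΩ : IsStrictlyConvexDomain Ω)
    (hO : IsCentrallySymmetric Ω O) {a b : Plane} (hb : O + b ∈ closure Ω) (hab : det2 a b ≠ 0)
    (hmax : ∀ t u, |det2 (γ t - O) (γ u - O)| ≤ |det2 a b|) : O + a ∉ Ω := by
  intro ha
  have hb' : O - b ∈ closure Ω := by
    convert hO.mem_closure hb using 1
    module
  obtain ⟨n, hn, hna⟩ : ∃ n, O - n ∈ closure Ω ∧ det2 n a = |det2 a b| := by
    rcases lt_or_gt_of_ne hab with h | h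
    · exact ⟨b, hb', by rw [abs_of_neg h, det2_comm]⟩
    · exact ⟨-b, by rwa [sub_neg_eq_add], by rw [abs_of_pos h, det2_neg_left, ← det2_comm]⟩
  have hpos : 0 < det2 n a := hna ▸ abs_pos.2 hab
  have hn0 : n ≠ 0 := by rintro rfl; simp [det2] at hpos
  -- first move `a`, then `-n = ± b`, to the boundary without decreasing the determinant
  obtain ⟨t, -, ht⟩ := hγ.exists_det2_max hΩ hn0
  have h1 := ht _ ha
  have h2 : det2 n a < det2 n (γ t - O) := by
    rw [det2_add_right] at h1; rw [det2_sub_right]; linarith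
  have hg0 : γ t - O ≠ 0 := by
    intro h0
    rw [h0] at h2
    simp only [det2, PiLp.zero_apply, mul_zero, sub_zero] at h2 hpos
    linarith
  obtain ⟨u, hu, -⟩ := hγ.exists_det2_max hΩ hg0
  have h3 := hu _ hn
  have h4 : det2 n (γ t - O) ≤ det2 (γ t - O) (γ u - O) := by
    rw [det2_sub_right _ O n, det2_comm _ n] at h3
    rw [det2_sub_right _ (γ u)]
    linarith
  have h5 := (le_abs_self _).trans (hmax t u)
  linarith

/-- In a Radon domain every boundary point belongs to a pair that maximizes `|det|`: by strict
convexity, the diagonals of a maximal inscribed parallelogram pass through the center. -/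
theorem IsRadon.exists_det2_max {Ω : Set Plane} {γ : Circ → Plane}
    {O : Plane} (hR : IsRadon Ω) (hγ : IsBoundaryParametrization Ω γ)
    (hΩ : IsStrictlyConvexDomain Ω) (hO : IsCentrallySymmetric Ω O) (t : Circ) :
    ∃ u, ∀ t' u', |det2 (γ t' - O) (γ u' - O)| ≤ |det2 (γ t - O) (γ u - O)| := by
  have hfr : ∀ w, γ w ∈ frontier Ω := fun w => hγ.range_eq ▸ mem_range_self w
  obtain ⟨q, r, s, ⟨hp, hq, hr, hs, hpar, hne⟩, hmax⟩ := hR.2 (γ t) (hfr t)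
  set a : Plane := (1 / 2 : ℝ) • (r - γ t) with ha
  set b : Plane := (1 / 2 : ℝ) • (s - q) with hb
  have hr_eq : r = q - γ t + s := by rw [hpar]; abel
  have harea : det2 (q - γ t) (s - γ t) = 2 * det2 a b := by
    rw [ha, hb, hr_eq]
    simp only [det2, PiLp.sub_apply, PiLp.add_apply, PiLp.smul_apply, smul_eq_mul]
    ring
  have hab : det2 a b ≠ 0 := fun h0 => hne (by rw [harea, h0, mul_zero])
  have hbound : ∀ t' u', |det2 (γ t' - O) (γ u' - O)| ≤ |det2 a b| := by
    intro t' u'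
    by_cases h0 : det2 (γ t' - O) (γ u' - O) = 0
    · rw [h0, abs_zero]; exact abs_nonneg _
    have hd : det2 (γ u' - γ t') ((2 : ℝ) • O - γ u' - γ t') =
        2 * det2 (γ t' - O) (γ u' - O) := by
      simp only [det2, PiLp.sub_apply, PiLp.smul_apply, smul_eq_mul]
      ring
    have h1 := hmax (γ t') (γ u') ((2 : ℝ) • O - γ t') ((2 : ℝ) • O - γ u')
      ⟨hfr _, hfr _, hO.mem_frontier (hfr _), hO.mem_frontier (hfr _), by abel,
        by rw [hd]; exact mul_ne_zero two_ne_zero h0⟩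
    rw [parallelogramArea, parallelogramArea, hd, harea, abs_mul, abs_mul] at h1
    exact le_of_mul_le_mul_left h1 (by norm_num)
  have hmid : ∀ x y : Plane,
      O + (1 / 2 : ℝ) • (x - y) = (1 / 2 : ℝ) • x + (1 / 2 : ℝ) • ((2 : ℝ) • O - y) := by
    intro x y; module
  have hcl : ∀ x ∈ frontier Ω, ∀ y ∈ frontier Ω, O + (1 / 2 : ℝ) • (x - y) ∈ closure Ω := by
    intro x hx y hy
    rw [hmid]
    exact hΩ.convex.closure (frontier_subset_closure hx)
      (frontier_subset_closure (hO.mem_frontier hy)) (by norm_num) (by norm_num) (by norm_num)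
  have hanti : ∀ x ∈ frontier Ω, ∀ y ∈ frontier Ω, O + (1 / 2 : ℝ) • (x - y) ∉ Ω →
      x = (2 : ℝ) • O - y := by
    intro x hx y hy hxy
    by_contra hne'
    refine hxy ?_
    rw [hmid]
    exact hΩ.midpoint_mem (frontier_subset_closure hx)
      (frontier_subset_closure (hO.mem_frontier hy)) hne'
  have hr' : r = (2 : ℝ) • O - γ t :=
    hanti r hr _ hp (hγ.notMem_of_det2_max hΩ hO (hcl s hs q hq) hab hbound)
  have hs' : s = (2 : ℝ) • O - q :=
    hanti s hs q hq (hγ.notMem_of_det2_max hΩ hO (a := b) (b := a) (hcl r hr _ hp)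
      (by rw [det2_comm]; exact neg_ne_zero.2 hab)
      (by rw [det2_comm b a, abs_neg]; exact hbound))
  rw [← hγ.range_eq] at hq
  obtain ⟨u, rfl⟩ := hq
  refine ⟨u, fun t' u' => (hbound t' u').trans_eq ?_⟩
  have ha' : a = -(γ t - O) := by rw [ha, hr']; module
  have hb' : b = -(γ u - O) := by rw [hb, hs']; module
  rw [ha', hb', det2_neg_left, det2_neg_right, neg_neg]

theorem IsSymmetricOval.height_eq_zero_of_det2_max {γ : Circ → Plane} {O : Plane}
    (h : IsSymmetricOval γ O) {t u : Circ}
    (hmax : ∀ w, |det2 (γ t - O) (γ w - O)| ≤ |det2 (γ t - O) (γ u - O)|) :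
    height γ O u t = 0 := by
  obtain ⟨x, rfl⟩ := QuotientAddGroup.mk_surjective u
  have hder := hasDerivAt_det2 (γ t - O) ((h.hasDerivAt x).sub_const O)
  have hext : IsLocalExtr (fun y : ℝ => det2 (γ t - O) (γ y - O)) x := by
    rcases le_total 0 (det2 (γ t - O) (γ (x : Circ) - O)) with h0 | h0
    · refine Or.inr (Eventually.of_forall fun y => ?_)
      exact (le_abs_self _).trans ((hmax y).trans_eq (abs_of_nonneg h0))
    · refine Or.inl (Eventually.of_forall fun y => ?_)
      have h1 := (neg_le_abs _).trans ((hmax y).trans_eq (abs_of_nonpos h0))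
      exact neg_le_neg_iff.1 h1
  have := hext.hasDerivAt_eq_zero hder
  rw [det2_comm] at this
  exact this

/-- In a Radon domain conjugacy is symmetric: if `γ(u) - O` is parallel to `γ'(t)`, then
`γ(t) - O` is parallel to `γ'(u)`. -/
theorem IsRadon.height_eq_zero_symm {Ω : Set Plane} {γ : Circ → Plane} {O : Plane}
    (hR : IsRadon Ω) (hγ : IsBoundaryParametrization Ω γ) (hΩ : IsStrictlyConvexDomain Ω)
    (hO : IsCentrallySymmetric Ω O) {t u : Circ} (htu : height γ O t u = 0) :
    height γ O u t = 0 := by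
  have h := hγ.isSymmetricOval hΩ hO
  obtain ⟨w, hw⟩ := hR.exists_det2_max hγ hΩ hO t
  have hwt : height γ O w t = 0 := h.height_eq_zero_of_det2_max fun u' => hw t u'
  have htw : height γ O t w = 0 := h.height_eq_zero_of_det2_max fun u' => by
    rw [det2_comm _ (γ u' - O), det2_comm _ (γ t - O), abs_neg, abs_neg]
    exact hw u' w
  have hopp : height γ O (opposite γ w) t = 0 := by
    obtain ⟨c, -, hc⟩ := h.exists_velocity_opposite w
    rw [height, neg_eq_zero] at hwt ⊢
    rw [hc, det2_neg_left, det2_smul_left, hwt, mul_zero, neg_zero]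
  -- up to the central symmetry, a point of height zero lies on the arc where heights are injective
  have hrep : ∀ z, height γ O t z = 0 →
      ∃ z', (z' = z ∨ z' = opposite γ z) ∧ 0 ≤ tangentDet γ t z' ∧ height γ O t z' = 0 := by
    intro z hz
    rcases le_total 0 (tangentDet γ t z) with h0 | h0
    · exact ⟨z, Or.inl rfl, h0, hz⟩
    · refine ⟨opposite γ z, Or.inr rfl, (h.tangentDet_opposite_right_nonneg_iff t z).2 ?_, ?_⟩
      · rw [tangentDet_comm]; linarith
      · rw [h.height_opposite_right, hz, neg_zero]
  obtain ⟨u', hu', hu0, huh⟩ := hrep u htu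
  obtain ⟨w', hw', hw0, hwh⟩ := hrep w htw
  obtain rfl : u' = w' := h.height_injOn t hu0 hw0 (huh.trans hwh.symm)
  rcases hu' with rfl | rfl
  · rcases hw' with rfl | rfl
    · exact hwt
    · exact hopp
  · have hu : u = opposite γ (opposite γ u) := (h.opposite_opposite u).symm
    rcases hw' with rfl | hw'
    · rwa [h.opposite_opposite] at hopp
    · rw [hw', h.opposite_opposite] at hu
      rwa [hu]

end SymplecticBilliard

theorem proposition2p13 (Ω : Set SymplecticBilliard.Plane)
    (γ : SymplecticBilliard.Circ → SymplecticBilliard.Plane) (O : SymplecticBilliard.Plane)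
    (hΩ : SymplecticBilliard.IsStrictlyConvexDomain Ω)
    (hγ : SymplecticBilliard.IsBoundaryParametrization Ω γ)
    (hRadon : SymplecticBilliard.IsRadon Ω)
    (hO : SymplecticBilliard.IsCentrallySymmetric Ω O)
    (lam : ℝ) (hlam : lam ∈ Set.Ioo (0 : ℝ) 1) (Λ : Set (SymplecticBilliard.Circ × ℝ)) :
    SymplecticBilliard.IsBirkhoffAttractor
        (SymplecticBilliard.lowerBoundary γ O) (SymplecticBilliard.upperBoundary γ O)
        (SymplecticBilliard.dissipativeBilliardMap γ O lam) Λ ↔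
      Λ = Set.univ ×ˢ {(0 : ℝ)} := by
  have h := hγ.isSymmetricOval hΩ hO
  rw [h.lowerBoundary_eq]
  exact (h.isDissipativeEmbedding (fun _ _ => hRadon.height_eq_zero_symm hγ hΩ hO)
    hlam).isBirkhoffAttractor_iff Λ
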